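/- **Definitions.** For $n,N\ge 1$, $\beta\ge 0$ and $\rho\in(0,1]$, the sparse Rademacher prior $\mathcal X_n^\rho$ is the law of a vector $x\in\mathbb R^n$ with i.i.d. entries equal to $+1/\sqrt{\rho n}$ and $-1/\sqrt{\rho n}$ with probability $\rho/2$ each and to $0$ with probability $1-\rho$. In the spiked Wishart model, $\mathbb Q_n$ is the law of $N$ independent samples $y^{(1)},\dots,y^{(N)}\sim\mathcal N(0,I_n)$, and under $\mathbb P_n$ one first draws $x\sim\mathcal X_n^\rho$ and then, given $x$, draws $N$ independent samples $y^{(1)},\dots,y^{(N)}\sim\mathcal N(0,I_n+\beta xx^\top)$. Let $L=d\mathbb P_n/d\mathbb Q_n$, let $L^{\le D}$ be the orthogonal projection of $L$, with respect to $\langle f,g\rangle=\mathbb E_{\mathbb Q_n}[fg]$, onto the polynomials of degree at most $D$ in the $nN$ entries of the samples (the polynomial $p$ of degree at most $D$ with $\mathbb E_{\mathbb Q_n}[(L-p)q]=0$ for all polynomials $q$ of degree at most $D$), and let $\|L^{\le D}\|=\mathbb E_{\mathbb Q_n}[(L^{\le D})^2]^{1/2}$. Put $\gamma=n/N$ and $\hat\lambda=\beta/\sqrt\gamma$.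 **Theorem.** There is an absolute constant $C>0$ such that the following holds. Let $N=N_n\ge 1$, $\beta=\beta_n\ge 0$, $\rho=\rho_n\in(0,1]$ and $D=D_n\in\mathbb N$ be sequences with $D_n\to\infty$ and $D_n=o(n)$ as $n\to\infty$. Suppose that either (a) $\liminf_{n\to\infty}\hat\lambda_n>1$, or (b) $\limsup_{n\to\infty}\hat\lambda_n<1$, $|\log\hat\lambda_n|=o(\sqrt{D_n})$, and for all sufficiently large $n$ $$\rho_n< C\,\hat\lambda_n\,\max\{1,\log(1/\hat\lambda_n)\}^{-2}\,\sqrt{\frac{D_n}{n}}.$$ Then $\|L_n^{\le D_n}\|\to\infty$ as $n\to\infty$. -/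

import Mathlib

open MeasureTheory ProbabilityTheory Filter Asymptotics Topology

noncomputable section

/-- The law of one entry of a sparse Rademacher vector in dimension `n` with sparsity `ρ`:
`±1/√(ρn)` with probability `ρ/2` each, and `0` with probability `1 - ρ`. -/
def sparseRademacherEntry (n : ℕ) (ρ : ℝ) : Measure ℝ :=
  ENNReal.ofReal (ρ / 2) • Measure.dirac (1 / √(ρ * n)) +
    ENNReal.ofReal (ρ / 2) • Measure.dirac (-(1 / √(ρ * n))) +
    ENNReal.ofReal (1 - ρ) • Measure.dirac 0

/-- The sparse Rademacher prior on `ℝⁿ`: i.i.d. entries. -/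
def sparseRademacherPrior (n : ℕ) (ρ : ℝ) : Measure (Fin n → ℝ) :=
  Measure.pi fun _ => sparseRademacherEntry n ρ

/-- The data space: `N` samples in `ℝⁿ`. -/
abbrev Samples (n N : ℕ) : Type := Fin N → EuclideanSpace ℝ (Fin n)

/-- `N` independent samples from `𝒩(0, Iₙ + β x xᵀ)`. -/
def spikedWishart (n N : ℕ) (β : ℝ) (x : Fin n → ℝ) : Measure (Samples n N) :=
  Measure.pi fun _ => multivariateGaussian 0 (1 + β • Matrix.vecMulVec x x)

/-- The planted distribution: draw the spike `x` from the prior, then the samples given `x`. -/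
def plantedWishart (n N : ℕ) (β : ℝ) (prior : Measure (Fin n → ℝ)) : Measure (Samples n N) :=
  prior.bind (spikedWishart n N β)

/-- The null distribution: `N` independent samples from `𝒩(0, Iₙ)`. -/
def nullWishart (n N : ℕ) : Measure (Samples n N) :=
  Measure.pi fun _ => multivariateGaussian 0 1

/-- The real function on the data space given by a polynomial in all the `N * n` entries. -/
def polyFun {n N : ℕ} (p : MvPolynomial (Fin N × Fin n) ℝ) (y : Samples n N) : ℝ :=
  MvPolynomial.eval (fun ij => y ij.1 ij.2) p

/-- `p` is the orthogonal projection of `f`, for the inner product `⟨g, h⟩ = 𝔼_{y ∼ Q} g(y) h(y)`,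
onto the polynomials of total degree at most `D`: it is such a polynomial, and `f - p` is
orthogonal to all of them. (All that is asked of `f` is that these inner products exist.) -/
def IsLowDegreeProjection {n N : ℕ} (Q : Measure (Samples n N)) (f : Samples n N → ℝ) (D : ℕ)
    (p : MvPolynomial (Fin N × Fin n) ℝ) : Prop :=
  p.totalDegree ≤ D ∧
    ∀ q : MvPolynomial (Fin N × Fin n) ℝ, q.totalDegree ≤ D →
      Integrable (fun y => (f y - polyFun p y) * polyFun q y) Q ∧
        ∫ y, (f y - polyFun p y) * polyFun q y ∂Q = 0

open Classical in
/-- The function `f^{≤D}`, the orthogonal projection of `f` onto the polynomials of degree at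
most `D` (and `0` if there is no such projection). -/
def lowDegreePart {n N : ℕ} (Q : Measure (Samples n N)) (f : Samples n N → ℝ) (D : ℕ) :
    Samples n N → ℝ :=
  if h : ∃ p, IsLowDegreeProjection Q f D p then polyFun h.choose else 0

/-- The likelihood ratio `L = dP/dQ` of the spiked Wishart model with a prior on the spike. -/
def wishartLikelihoodRatio (n N : ℕ) (β : ℝ) (prior : Measure (Fin n → ℝ)) (y : Samples n N) :
    ℝ :=
  ((plantedWishart n N β prior).rnDeriv (nullWishart n N) y).toReal

/-- `‖L^{≤D}‖`, the norm in `L²(Q)` of the low-degree likelihood ratio. -/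
def wishartLDLRNorm (n N : ℕ) (β : ℝ) (prior : Measure (Fin n → ℝ)) (D : ℕ) : ℝ :=
  √(∫ y, (lowDegreePart (nullWishart n N) (wishartLikelihoodRatio n N β prior) D y) ^ 2
      ∂(nullWishart n N))

/-- The signal-to-noise ratio `β / √γ`, where `γ = n / N`. -/
def wishartSNR (n N : ℕ) (β : ℝ) : ℝ :=
  β / √((n : ℝ) / N)

end

/-! The norm of `L^{≤D}` is at least that of the Hermite component of `L` of any single degree `m ≤
D`. Hermite coefficients of `L` are planted expectations. Given the spike `x` and Gaussian scalars
`g`, the samples are white noise shifted by `√β g_k x_i`, so these coefficients are mixed moments of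
the signal. Summing their normalized squares gives a moment of the overlap of two independent
copies, which factors because the signal has rank one: `β^m / m! * E⟨x,x'⟩^m * E⟨g,g'⟩^m`
(`overlap_moment_le_sq_wishartLDLRNorm`).

Both overlap moments are sums of nonnegative terms over multi-indices, so any subfamily gives a
lower bound. For `g` the even multi-indices are kept; for `x`, those equal to `2m` on `k`
coordinates and `0` elsewhere (`le_sq_wishartLDLRNorm`). What remains is to choose `k` and `m` with
`2km ≤ D`.

Above the threshold, `m = 1`: the sparsity cancels and the bound is `snr^(2k)` up to factors that
are harmless when `D = o(n)` (`le_sq_wishartLDLRNorm_of_snr`). Below it, `m` is comparable to `L =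
max 1 (log (1/snr))`. With `d = km`, each of the `k` coordinates contributes `snr²/(16m) * A^(m-1)`,
where `A = snr² d / (8ρ²nm²)`. Sparsity makes `A` large, and `m ≥ L` makes the loss `snr²` at most
exponential in `m`, so the contribution is at least `2^m` (`two_pow_le_of_sparse`) and the squared
norm is at least `2^(km)` with `km ≥ D/4`. -/

/-! ### Functions with finite moments -/

/-- All the moments of `f` under `μ` are finite. -/
def HasAllMoments {Ω : Type*} [MeasurableSpace Ω] (f : Ω → ℝ) (μ : Measure Ω) : Prop :=
  ∀ p : ℕ, MemLp f p μ

namespace HasAllMoments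

variable {Ω : Type*} [MeasurableSpace Ω] {μ : Measure Ω} {f g : Ω → ℝ}

lemma integrable (hf : HasAllMoments f μ) : Integrable f μ :=
  memLp_one_iff_integrable.1 (by simpa using hf 1)

lemma add (hf : HasAllMoments f μ) (hg : HasAllMoments g μ) :
    HasAllMoments (fun ω => f ω + g ω) μ := fun p => (hf p).add (hg p)

lemma mul (hf : HasAllMoments f μ) (hg : HasAllMoments g μ) :
    HasAllMoments (fun ω => f ω * g ω) μ := fun p => by
  -- Cauchy-Schwarz: a product of two functions in `L^{2p}` lies in `L^p`.
  have _h : ENNReal.HolderTriple ((2 * p : ℕ) : ENNReal) ((2 * p : ℕ) : ENNReal) (p : ENNReal) := by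
    constructor
    rcases Nat.eq_zero_or_pos p with rfl | hp
    · simp
    · push_cast
      rw [ENNReal.mul_inv (by simp) (by simp), ← add_mul, ENNReal.inv_two_add_inv_two, one_mul]
  exact (hg (2 * p)).mul (hf (2 * p))

lemma const [IsFiniteMeasure μ] (c : ℝ) : HasAllMoments (fun _ => c) μ := fun _ => memLp_const c

lemma pow [IsFiniteMeasure μ] (hf : HasAllMoments f μ) (k : ℕ) :
    HasAllMoments (fun ω => f ω ^ k) μ := by
  induction k with
  | zero => simpa using const (μ := μ) 1
  | succ k ih => simpa only [pow_succ] using ih.mul hf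

lemma eval_mvPolynomial [IsFiniteMeasure μ] {σ : Type*} {X : σ → Ω → ℝ}
    (hX : ∀ i, HasAllMoments (X i) μ) (q : MvPolynomial σ ℝ) :
    HasAllMoments (fun ω => MvPolynomial.eval (fun i => X i ω) q) μ := by
  induction q using MvPolynomial.induction_on with
  | C a => simpa using const a
  | add p q hp hq => simpa using hp.add hq
  | mul_X p i hp => simpa using hp.mul (hX i)

lemma eval_polynomial [IsFiniteMeasure μ] (hf : HasAllMoments f μ) (q : Polynomial ℝ) :
    HasAllMoments (fun ω => q.eval (f ω)) μ := by
  induction q using Polynomial.induction_on with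
  | C a => simpa using const a
  | add p q hp hq => simpa using hp.add hq
  | monomial n a h => simpa using (const a).mul (hf.pow (n + 1))

lemma comp_measurePreserving {Ω' : Type*} [MeasurableSpace Ω'] {ν : Measure Ω'} {φ : Ω' → Ω}
    (hf : HasAllMoments f μ) (hφ : MeasurePreserving φ ν μ) :
    HasAllMoments (fun ω => f (φ ω)) ν := fun p => (hf p).comp_measurePreserving hφ

end HasAllMoments

/-! ### Gaussian integration by parts and Hermite polynomials -/

lemma hasAllMoments_gaussianReal : HasAllMoments (fun x => x) (gaussianReal 0 1) :=
  fun p => memLp_id_gaussianReal p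

lemma integrable_polynomial_gaussianReal (p : Polynomial ℝ) :
    Integrable (fun x => p.eval x) (gaussianReal 0 1) :=
  (hasAllMoments_gaussianReal.eval_polynomial p).integrable

lemma integrable_gaussianPDFReal_mul_polynomial (p : Polynomial ℝ) :
    Integrable (fun x => gaussianPDFReal 0 1 x * p.eval x) := by
  have h := integrable_polynomial_gaussianReal p
  rw [gaussianReal_of_var_ne_zero 0 one_ne_zero,
    integrable_withDensity_iff_integrable_smul₀' (measurable_gaussianPDF 0 1).aemeasurable
      (by simp [gaussianPDF_lt_top])] at h
  simpa [toReal_gaussianPDF] using h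

lemma hasDerivAt_gaussianPDFReal (x : ℝ) :
    HasDerivAt (gaussianPDFReal 0 1) (-(x * gaussianPDFReal 0 1 x)) x := by
  rw [gaussianPDFReal_def]
  have h : HasDerivAt (fun x : ℝ => -(x - 0) ^ 2 / (2 * (1 : NNReal))) (-x) x := by
    have := (((hasDerivAt_id x).sub_const 0).pow 2).neg.div_const (2 * ((1 : NNReal) : ℝ))
    refine this.congr_deriv ?_
    simp
    ring
  refine (h.exp.const_mul ((√(2 * Real.pi * (1 : NNReal)))⁻¹)).congr_deriv ?_
  ring

/-- Gaussian integration by parts, for polynomials. -/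
lemma integral_mul_polynomial_gaussianReal (p : Polynomial ℝ) :
    ∫ x, x * p.eval x ∂(gaussianReal 0 1) = ∫ x, p.derivative.eval x ∂(gaussianReal 0 1) := by
  have hd : ∀ x : ℝ, HasDerivAt (fun x => gaussianPDFReal 0 1 x * p.eval x)
      (gaussianPDFReal 0 1 x * (p.derivative - Polynomial.X * p).eval x) x := fun x => by
    refine ((hasDerivAt_gaussianPDFReal x).mul (p.hasDerivAt x)).congr_deriv ?_
    simp only [Polynomial.eval_sub, Polynomial.eval_mul, Polynomial.eval_X]
    ring
  have h := integral_eq_zero_of_hasDerivAt_of_integrable hd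
    (integrable_gaussianPDFReal_mul_polynomial _) (integrable_gaussianPDFReal_mul_polynomial p)
  have h2 : ∫ x, (p.derivative - Polynomial.X * p).eval x ∂(gaussianReal 0 1) = 0 := by
    rw [integral_gaussianReal_eq_integral_smul one_ne_zero]
    exact h
  simp only [Polynomial.eval_sub] at h2
  rw [integral_sub (integrable_polynomial_gaussianReal _)
    (integrable_polynomial_gaussianReal _), sub_eq_zero] at h2
  rw [h2]
  simp only [Polynomial.eval_mul, Polynomial.eval_X]

/-- The probabilists' Hermite polynomials, with real coefficients. -/
noncomputable def realHermite (n : ℕ) : Polynomial ℝ :=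
  (Polynomial.hermite n).map (Int.castRingHom ℝ)

lemma realHermite_zero : realHermite 0 = 1 := by simp [realHermite]

lemma realHermite_succ (n : ℕ) :
    realHermite (n + 1) =
      Polynomial.X * realHermite n - Polynomial.derivative (realHermite n) := by
  simp [realHermite, Polynomial.hermite_succ, Polynomial.derivative_map]

lemma natDegree_realHermite (n : ℕ) : (realHermite n).natDegree = n := by
  rw [realHermite, (Polynomial.hermite_monic n).natDegree_map, Polynomial.natDegree_hermite]

lemma monic_realHermite (n : ℕ) : (realHermite n).Monic := (Polynomial.hermite_monic n).map _

/-- By Gaussian integration by parts, `p ↦ X * p - p'` is adjoint to the derivative; the Hermite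
recursion applies this operator `n` times to `1`. -/
lemma integral_realHermite_mul (n : ℕ) (p : Polynomial ℝ) :
    ∫ x, (realHermite n).eval x * p.eval x ∂(gaussianReal 0 1) =
      ∫ x, (Polynomial.derivative^[n] p).eval x ∂(gaussianReal 0 1) := by
  induction n generalizing p with
  | zero => simp [realHermite_zero]
  | succ n ih =>
    rw [Function.iterate_succ_apply, ← ih]
    have h := integral_mul_polynomial_gaussianReal (realHermite n * p)
    simp only [realHermite_succ, Polynomial.eval_sub, Polynomial.eval_mul, Polynomial.eval_X,
      Polynomial.derivative_mul, Polynomial.eval_add] at h ⊢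
    have i1 := integrable_polynomial_gaussianReal (Polynomial.derivative (realHermite n) * p)
    have i2 := integrable_polynomial_gaussianReal (realHermite n * Polynomial.derivative p)
    have i3 := integrable_polynomial_gaussianReal (Polynomial.X * (realHermite n * p))
    simp only [Polynomial.eval_mul, Polynomial.eval_X] at i1 i2 i3
    rw [integral_add i1 i2] at h
    simp only [sub_mul, mul_assoc]
    rw [integral_sub i3 i1, h]
    ring

/-- Orthogonality of the Hermite polynomials. -/
lemma integral_realHermite_mul_realHermite (a b : ℕ) :
    ∫ x, (realHermite a).eval x * (realHermite b).eval x ∂(gaussianReal 0 1) =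
      if a = b then (a.factorial : ℝ) else 0 := by
  wlog hab : b ≤ a generalizing a b
  · have := this b a (by omega)
    simp_rw [mul_comm ((realHermite a).eval _), this]
    by_cases h : a = b
    · simp [h]
    · simp [h, Ne.symm h]
  rw [integral_realHermite_mul]
  split_ifs with h
  · subst h
    have : (Polynomial.derivative^[a] (realHermite a)) = Polynomial.C (a.factorial : ℝ) := by
      ext k
      rw [Polynomial.coeff_iterate_derivative, Polynomial.coeff_C]
      split_ifs with hk
      · subst hk
        have := monic_realHermite a
        rw [Polynomial.Monic, Polynomial.leadingCoeff, natDegree_realHermite] at this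
        simp [this, Nat.descFactorial_self]
      · rw [Polynomial.coeff_eq_zero_of_natDegree_lt]
        · simp
        · rw [natDegree_realHermite]; omega
    simp [this]
  · rw [Polynomial.iterate_derivative_eq_zero]
    · simp
    · rw [natDegree_realHermite]; omega

/-- In the recursion at `z + w`, integration by parts cancels the term with factor `z` against the
derivative, leaving a factor `w`. This turns Hermite coefficients of shifted noise into monomials in
the shift. -/
lemma integral_realHermite_add (n : ℕ) (w : ℝ) :
    ∫ z, (realHermite n).eval (z + w) ∂(gaussianReal 0 1) = w ^ n := by
  induction n with
  | zero => simp [realHermite_zero]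
  | succ n ih =>
    set p : Polynomial ℝ := (realHermite n).comp (Polynomial.X + Polynomial.C w) with hp
    have h := integral_mul_polynomial_gaussianReal p
    have hd : Polynomial.derivative p =
        (Polynomial.derivative (realHermite n)).comp (Polynomial.X + Polynomial.C w) := by
      simp [hp, Polynomial.derivative_comp]
    have i1 := integrable_polynomial_gaussianReal (Polynomial.X * p)
    have i2 := integrable_polynomial_gaussianReal p
    have i3 := integrable_polynomial_gaussianReal (Polynomial.derivative p)
    rw [hd] at h i3
    simp only [hp, Polynomial.eval_comp, Polynomial.eval_add, Polynomial.eval_X,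
      Polynomial.eval_C, Polynomial.eval_mul] at h i1 i2 i3
    simp only [realHermite_succ, Polynomial.eval_sub, Polynomial.eval_mul, Polynomial.eval_X,
      add_mul]
    have i4 := i2.const_mul w
    have i5 : Integrable (fun z => z * (realHermite n).eval (z + w) +
      w * (realHermite n).eval (z + w)) (gaussianReal 0 1) := i1.add i4
    rw [integral_sub i5 i3, integral_add i1 i4, h, integral_const_mul, ih]
    ring

/-- The even moments of the standard Gaussian. -/
lemma integral_pow_two_mul_gaussianReal (k : ℕ) :
    ∫ x, x ^ (2 * k) ∂(gaussianReal 0 1) = (2 * k).factorial / (2 ^ k * k.factorial) := by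
  induction k with
  | zero => simp
  | succ k ih =>
    have h := integral_mul_polynomial_gaussianReal (Polynomial.X ^ (2 * k + 1))
    simp only [Polynomial.eval_pow, Polynomial.eval_X, Polynomial.derivative_X_pow,
      Polynomial.eval_mul, ← pow_succ', Polynomial.eval_C, integral_const_mul,
      Nat.add_sub_cancel, ih] at h
    rw [show 2 * (k + 1) = 2 * k + 1 + 1 by ring, h, Nat.factorial_succ, Nat.factorial_succ,
      Nat.factorial_succ]
    push_cast
    field_simp
    ring

/-! ### Existence of the low-degree projection, and duality -/

/-- A linear functional that vanishes on the null vectors of a symmetric bilinear form on a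
finite-dimensional space is represented by a vector. -/
lemma exists_representer {V : Type*} [AddCommGroup V] [Module ℝ V] [FiniteDimensional ℝ V]
    (B : V →ₗ[ℝ] V →ₗ[ℝ] ℝ) (hB : ∀ v w, B v w = B w v) (l : V →ₗ[ℝ] ℝ)
    (hl : ∀ v, B v v = 0 → l v = 0) : ∃ p, ∀ q, B p q = l q := by
  have h : l ∈ (LinearMap.ker B).dualAnnihilator := by
    rw [Submodule.mem_dualAnnihilator]
    intro v hv
    exact hl v (by rw [LinearMap.mem_ker.1 hv]; rfl)
  -- In finite dimension, the functionals that kill `ker B` are the range of the transpose of `B`,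
  -- and its argument in the bidual is evaluation at a vector.
  rw [← LinearMap.range_dualMap_eq_dualAnnihilator_ker] at h
  obtain ⟨φ, hφ⟩ := h
  refine ⟨(Module.evalEquiv ℝ V).symm φ, fun q => ?_⟩
  rw [← hφ, hB, LinearMap.dualMap_apply]
  simp

lemma polyFun_add {n N : ℕ} (p q : MvPolynomial (Fin N × Fin n) ℝ) (y : Samples n N) :
    polyFun (p + q) y = polyFun p y + polyFun q y := by simp [polyFun]

lemma polyFun_smul {n N : ℕ} (c : ℝ) (p : MvPolynomial (Fin N × Fin n) ℝ) (y : Samples n N) :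
    polyFun (c • p) y = c * polyFun p y := by simp [polyFun, MvPolynomial.smul_eval]

section Projection

variable {n N : ℕ} {Q : Measure (Samples n N)} [IsFiniteMeasure Q] {f : Samples n N → ℝ} {D : ℕ}

lemma hasAllMoments_polyFun (hQ : ∀ k i, HasAllMoments (fun y : Samples n N => y k i) Q)
    (p : MvPolynomial (Fin N × Fin n) ℝ) : HasAllMoments (polyFun p) Q :=
  HasAllMoments.eval_mvPolynomial (X := fun (ki : Fin N × Fin n) (y : Samples n N) => y ki.1 ki.2)
    (fun ki => hQ ki.1 ki.2) p

/-- Without existence, `lowDegreePart` takes its default value `0`. Integrability of `f` against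
polynomials suffices, so `f` need not be in `L²`; the form may be degenerate, since a null vector
vanishes almost everywhere and pairs to zero with `f`. -/
lemma exists_isLowDegreeProjection (hQ : ∀ k i, HasAllMoments (fun y : Samples n N => y k i) Q)
    (hf : ∀ q : MvPolynomial (Fin N × Fin n) ℝ, Integrable (fun y => f y * polyFun q y) Q) :
    ∃ p, IsLowDegreeProjection Q f D p := by
  have hint : ∀ p q : MvPolynomial (Fin N × Fin n) ℝ,
      Integrable (fun y => polyFun p y * polyFun q y) Q := fun p q =>
    ((hasAllMoments_polyFun hQ p).mul (hasAllMoments_polyFun hQ q)).integrable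
  let V := MvPolynomial.restrictTotalDegree (Fin N × Fin n) ℝ D
  let B : V →ₗ[ℝ] V →ₗ[ℝ] ℝ := LinearMap.mk₂ ℝ
    (fun p q => ∫ y, polyFun p.1 y * polyFun q.1 y ∂Q)
    (fun p p' q => by
      simp only [Submodule.coe_add, polyFun_add, add_mul]
      exact integral_add (hint _ _) (hint _ _))
    (fun c p q => by
      simp only [Submodule.coe_smul, polyFun_smul, mul_assoc, integral_const_mul, smul_eq_mul])
    (fun p q q' => by
      simp only [Submodule.coe_add, polyFun_add, mul_add]
      exact integral_add (hint _ _) (hint _ _))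
    (fun c p q => by
      simp only [Submodule.coe_smul, polyFun_smul, mul_left_comm _ c, integral_const_mul,
        smul_eq_mul])
  let l : V →ₗ[ℝ] ℝ :=
    { toFun := fun q => ∫ y, f y * polyFun q.1 y ∂Q
      map_add' := fun q q' => by
        simp only [Submodule.coe_add, polyFun_add, mul_add]
        exact integral_add (hf _) (hf _)
      map_smul' := fun c q => by
        simp only [Submodule.coe_smul, polyFun_smul, mul_left_comm _ c, integral_const_mul,
          smul_eq_mul, RingHom.id_apply] }
  obtain ⟨p, hp⟩ := exists_representer B
    (fun v w => integral_congr_ae (Eventually.of_forall fun y => mul_comm _ _)) l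
    (fun v hv => by
      have h0 : (fun y => polyFun v.1 y * polyFun v.1 y) =ᵐ[Q] 0 :=
        (integral_eq_zero_iff_of_nonneg (fun y => mul_self_nonneg _) (hint v.1 v.1)).1 hv
      refine integral_eq_zero_of_ae (h0.mono fun y hy => ?_)
      have : polyFun v.1 y = 0 := mul_self_eq_zero.1 hy
      simp [this])
  refine ⟨p.1, (MvPolynomial.mem_restrictTotalDegree _ _ _).1 p.2, fun q hq => ?_⟩
  have h := hp ⟨q, (MvPolynomial.mem_restrictTotalDegree _ _ _).2 hq⟩
  simp only [sub_mul]
  exact ⟨(hf q).sub (hint p.1 q), by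
    rw [integral_sub (hf q) (hint p.1 q), sub_eq_zero]
    exact h.symm⟩

/-- Duality: a polynomial `g` of degree at most `D` with `⟨f, g⟩ = ⟨g, g⟩` bounds the norm of the
projection of `f` from below. -/
lemma integral_sq_le_integral_lowDegreePart_sq
    (hQ : ∀ k i, HasAllMoments (fun y : Samples n N => y k i) Q)
    (hf : ∀ q : MvPolynomial (Fin N × Fin n) ℝ, Integrable (fun y => f y * polyFun q y) Q)
    {g : MvPolynomial (Fin N × Fin n) ℝ} (hg : g.totalDegree ≤ D)
    (hfg : ∫ y, f y * polyFun g y ∂Q = ∫ y, polyFun g y ^ 2 ∂Q) :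
    ∫ y, polyFun g y ^ 2 ∂Q ≤ ∫ y, lowDegreePart Q f D y ^ 2 ∂Q := by
  have hex : ∃ p, IsLowDegreeProjection Q f D p := exists_isLowDegreeProjection hQ hf
  rw [lowDegreePart, dif_pos hex]
  obtain ⟨-, hp⟩ := hex.choose_spec
  set p := hex.choose
  have hint : ∀ p q : MvPolynomial (Fin N × Fin n) ℝ,
      Integrable (fun y => polyFun p y * polyFun q y) Q := fun p q =>
    ((hasAllMoments_polyFun hQ p).mul (hasAllMoments_polyFun hQ q)).integrable
  have h1 := (hp g hg).2
  simp only [sub_mul] at h1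
  rw [integral_sub (hf g) (hint p g), hfg, sub_eq_zero] at h1
  -- Here `⟨p, g⟩ = ⟨g, g⟩`, so `‖p - g‖² = ‖p‖² - ‖g‖²`.
  have h2 : 0 ≤ ∫ y, (polyFun p y - polyFun g y) ^ 2 ∂Q :=
    integral_nonneg fun y => sq_nonneg _
  have h3 : ∫ y, (polyFun p y - polyFun g y) ^ 2 ∂Q =
      ∫ y, polyFun p y ^ 2 ∂Q - 2 * ∫ y, polyFun p y * polyFun g y ∂Q +
        ∫ y, polyFun g y ^ 2 ∂Q := by
    have ip := hint p p
    have ig := hint g g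
    simp only [← pow_two] at ip ig
    have i2 := (hint p g).const_mul 2
    have i3 : Integrable (fun y => polyFun p y ^ 2 - 2 * (polyFun p y * polyFun g y)) Q :=
      ip.sub i2
    rw [← integral_const_mul, ← integral_sub ip i2, ← integral_add i3 ig]
    congr 1 with y
    ring
  linarith

end Projection

/-! ### The planted law as an image of independent noise, and its absolute continuity -/

lemma absolutelyContinuous_pi {α : Type*} [MeasurableSpace α] {k : ℕ} {μ ν : Fin k → Measure α}
    [∀ i, SigmaFinite (μ i)] [∀ i, SigmaFinite (ν i)] (h : ∀ i, μ i ≪ ν i) :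
    Measure.pi μ ≪ Measure.pi ν := by
  induction k with
  | zero => rw [Measure.pi_of_empty μ, Measure.pi_of_empty ν]
  | succ k ih =>
    have hμ := (measurePreserving_piFinSuccAbove μ 0).symm
    have hν := (measurePreserving_piFinSuccAbove ν 0).symm
    rw [← hμ.map_eq, ← hν.map_eq]
    exact ((h 0).prod (ih fun i => h _)).map (MeasurableEquiv.measurable _)

/-- The standard Gaussian measure on `Fin n → ℝ`. -/
noncomputable abbrev gaussianPi (n : ℕ) : Measure (Fin n → ℝ) :=
  Measure.pi fun _ => gaussianReal 0 1

/-- A sample of the spiked model, as a function of white noise `p.1` and of a scalar Gaussian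
variable `p.2`. -/
noncomputable def spikedSample {n : ℕ} (β : ℝ) (x : Fin n → ℝ) (p : (Fin n → ℝ) × ℝ) :
    EuclideanSpace ℝ (Fin n) :=
  WithLp.toLp 2 fun i => p.1 i + √β * p.2 * x i

lemma measurable_spikedSample {n : ℕ} (β : ℝ) (x : Fin n → ℝ) :
    Measurable (spikedSample β x) := by
  unfold spikedSample
  fun_prop

lemma posSemidef_one_add_vecMulVec {n : ℕ} {β : ℝ} (hβ : 0 ≤ β) (x : Fin n → ℝ) :
    (1 + β • Matrix.vecMulVec x x).PosSemidef := by
  refine Matrix.PosSemidef.one.add (Matrix.PosSemidef.smul ?_ hβ)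
  simpa using Matrix.posSemidef_vecMulVec_self_star x

lemma charFun_map_smul_const {n : ℕ} (v s : EuclideanSpace ℝ (Fin n)) :
    charFun ((gaussianReal 0 1).map fun t => t • v) s =
      Complex.exp (-((inner ℝ v s : ℝ) : ℂ) ^ 2 / 2) := by
  have h := charFun_gaussianReal (μ := 0) (v := 1) (inner ℝ v s)
  rw [charFun_apply_real] at h
  rw [charFun_apply, integral_map (by fun_prop) (by fun_prop)]
  simp only [inner_smul_left, Complex.ofReal_mul]
  simp only [conj_trivial]
  simp_rw [mul_comm (Complex.ofReal _) (Complex.ofReal (inner ℝ v s))]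
  rw [h]
  congr 1
  simp
  ring

/-- The Gaussian with a spiked covariance matrix is white noise plus a random multiple of the
spike. -/
lemma multivariateGaussian_one_add_vecMulVec {n : ℕ} {β : ℝ} (hβ : 0 ≤ β) (x : Fin n → ℝ) :
    multivariateGaussian 0 (1 + β • Matrix.vecMulVec x x) =
      ((gaussianPi n).prod (gaussianReal 0 1)).map (spikedSample β x) := by
  set v : EuclideanSpace ℝ (Fin n) := WithLp.toLp 2 fun i => √β * x i with hv
  have h1 : ((gaussianPi n).prod (gaussianReal 0 1)).map (spikedSample β x) =
      ((stdGaussian (EuclideanSpace ℝ (Fin n))).prod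
        ((gaussianReal 0 1).map fun t => t • v)).map fun p => p.1 + p.2 := by
    rw [← map_pi_eq_stdGaussian, Measure.map_prod_map _ _ (by fun_prop) (by fun_prop),
      Measure.map_map (by fun_prop) (by fun_prop)]
    congr 1
    ext p i
    simp [spikedSample, hv]
    ring
  have : IsProbabilityMeasure ((gaussianReal 0 1).map fun t => t • v) :=
    Measure.isProbabilityMeasure_map (by fun_prop)
  have : IsProbabilityMeasure (((gaussianPi n).prod (gaussianReal 0 1)).map (spikedSample β x)) :=
    Measure.isProbabilityMeasure_map (measurable_spikedSample β x).aemeasurable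
  refine Measure.ext_of_charFun ?_
  ext s
  rw [h1, charFun_map_add_prod_eq_mul, Pi.mul_apply, charFun_stdGaussian, charFun_map_smul_const,
    charFun_multivariateGaussian (posSemidef_one_add_vecMulVec hβ x), ← Complex.exp_add]
  congr 1
  have h2 : (inner ℝ v s : ℝ) = √β * ∑ i, x i * s i := by
    simp [PiLp.inner_apply, hv, Finset.mul_sum]
    exact Finset.sum_congr rfl fun i _ => by ring
  have h3 : (s.ofLp ⬝ᵥ (1 + β • Matrix.vecMulVec x x).mulVec s.ofLp) =
      ‖s‖ ^ 2 + (inner ℝ v s : ℝ) ^ 2 := by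
    rw [h2, mul_pow, Real.sq_sqrt hβ, EuclideanSpace.real_norm_sq_eq, Matrix.add_mulVec,
      dotProduct_add, Matrix.one_mulVec, Matrix.smul_mulVec, dotProduct_smul,
      Matrix.vecMulVec_mulVec]
    simp [dotProduct, pow_two, Finset.sum_mul, Finset.mul_sum]
    exact Finset.sum_congr rfl fun i _ => Finset.sum_congr rfl fun j _ => by ring
  rw [h3]
  simp only [inner_zero_right, Complex.ofReal_zero, zero_mul, Complex.ofReal_add,
    Complex.ofReal_pow]
  ring

/-- Given the scalar `t`, the sample is a translate of white noise, whose law is absolutely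
continuous with respect to white noise; Fubini integrates this over `t`. Absolute continuity lets
integrals against `L` be computed under the planted law. -/
lemma multivariateGaussian_spike_absolutelyContinuous {n : ℕ} {β : ℝ} (hβ : 0 ≤ β)
    (x : Fin n → ℝ) :
    multivariateGaussian 0 (1 + β • Matrix.vecMulVec x x) ≪
      multivariateGaussian (0 : EuclideanSpace ℝ (Fin n)) 1 := by
  rw [multivariateGaussian_one_add_vecMulVec hβ, multivariateGaussian_zero_one,
    ← map_pi_eq_stdGaussian]
  have hm : Measurable (fun p : (Fin n → ℝ) × ℝ => fun i => p.1 i + √β * p.2 * x i) := by fun_prop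
  have : spikedSample β x = WithLp.toLp 2 ∘ fun p => fun i => p.1 i + √β * p.2 * x i := rfl
  rw [this, ← Measure.map_map (by fun_prop) hm]
  refine Measure.AbsolutelyContinuous.map ?_ (by fun_prop)
  refine Measure.AbsolutelyContinuous.mk fun s hs h0 => ?_
  rw [Measure.map_apply hm hs, Measure.prod_apply_symm (hm hs)]
  refine lintegral_eq_zero_of_ae_eq_zero (Eventually.of_forall fun t => ?_)
  have hshift : (gaussianPi n).map (fun z i => z i + √β * t * x i) =
      Measure.pi fun i => gaussianReal (√β * t * x i) 1 := by
    rw [Measure.pi_map_pi (f := fun i z => z + √β * t * x i) (fun i => by fun_prop)]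
    simp [gaussianReal_map_add_const]
  have hac : (gaussianPi n).map (fun z i => z i + √β * t * x i) ≪ gaussianPi n := by
    rw [hshift]
    exact absolutelyContinuous_pi fun i =>
      (gaussianReal_absolutelyContinuous _ one_ne_zero).trans
        (gaussianReal_absolutelyContinuous' _ one_ne_zero)
  have h := hac h0
  rwa [Measure.map_apply (by fun_prop) hs] at h

/-- White noise and scalar Gaussian variables for `N` samples. -/
noncomputable abbrev noiseLaw (n N : ℕ) : Measure (Fin N → (Fin n → ℝ) × ℝ) :=
  Measure.pi fun _ => (gaussianPi n).prod (gaussianReal 0 1)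

/-- The samples, as a function of the spike and of the noise. -/
noncomputable def spikedSamples {n N : ℕ} (β : ℝ)
    (ω : (Fin n → ℝ) × (Fin N → (Fin n → ℝ) × ℝ)) : Samples n N :=
  fun k => spikedSample β ω.1 (ω.2 k)

lemma measurable_spikedSamples {n N : ℕ} (β : ℝ) :
    Measurable (spikedSamples (n := n) (N := N) β) := by
  unfold spikedSamples spikedSample
  fun_prop

lemma nullWishart_eq_map (n N : ℕ) :
    nullWishart n N =
      (Measure.pi fun _ : Fin N => gaussianPi n).map fun z k => WithLp.toLp 2 (z k) := by
  rw [Measure.pi_map_pi (f := fun (_ : Fin N) (z : Fin n → ℝ) => WithLp.toLp 2 z)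
    (fun _ => by fun_prop)]
  simp_rw [nullWishart, multivariateGaussian_zero_one, map_pi_eq_stdGaussian]

lemma spikedWishart_eq_map {n N : ℕ} {β : ℝ} (hβ : 0 ≤ β) (x : Fin n → ℝ) :
    spikedWishart n N β x = (noiseLaw n N).map fun ω => spikedSamples β (x, ω) := by
  have h : (fun ω : Fin N → (Fin n → ℝ) × ℝ => spikedSamples β (x, ω)) =
      fun ω k => spikedSample β x (ω k) := rfl
  have : IsProbabilityMeasure (((gaussianPi n).prod (gaussianReal 0 1)).map (spikedSample β x)) :=
    Measure.isProbabilityMeasure_map (measurable_spikedSample β x).aemeasurable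
  rw [h, Measure.pi_map_pi (f := fun (_ : Fin N) p => spikedSample β x p)
    (fun _ => (measurable_spikedSample β x).aemeasurable)]
  simp_rw [spikedWishart, multivariateGaussian_one_add_vecMulVec hβ]

instance (n N : ℕ) : IsProbabilityMeasure (nullWishart n N) := by
  unfold nullWishart
  infer_instance

lemma spikedWishart_absolutelyContinuous {n N : ℕ} {β : ℝ} (hβ : 0 ≤ β) (x : Fin n → ℝ) :
    spikedWishart n N β x ≪ nullWishart n N :=
  absolutelyContinuous_pi fun _ => multivariateGaussian_spike_absolutelyContinuous hβ x

lemma plantedWishart_eq_map {n N : ℕ} {β : ℝ} (hβ : 0 ≤ β) (prior : Measure (Fin n → ℝ))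
    [SFinite prior] :
    plantedWishart n N β prior = (prior.prod (noiseLaw n N)).map (spikedSamples β) := by
  have hm := measurable_spikedSamples (n := n) (N := N) β
  have heq : spikedWishart n N β =
      fun x => (noiseLaw n N).map fun ω => spikedSamples β (x, ω) :=
    funext fun x => spikedWishart_eq_map hβ x
  have happ : ∀ {s}, MeasurableSet s → ∀ x, spikedWishart n N β x s =
      noiseLaw n N (Prod.mk x ⁻¹' (spikedSamples β ⁻¹' s)) := fun hs x => by
    rw [heq, Measure.map_apply (by fun_prop) hs]
    rfl
  -- The formula for `Measure.bind` needs a measurable kernel; measurability comes from writing the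
  -- kernel as the image of a fixed noise law.
  have hmeas : Measurable (spikedWishart n N β) := by
    refine Measure.measurable_of_measurable_coe _ fun s hs => ?_
    simp_rw [happ hs]
    exact measurable_measure_prodMk_left (hm hs)
  ext s hs
  rw [plantedWishart, Measure.bind_apply hs hmeas.aemeasurable, Measure.map_apply hm hs,
    Measure.prod_apply (hm hs)]
  simp_rw [happ hs]

lemma plantedWishart_absolutelyContinuous {n N : ℕ} {β : ℝ} (hβ : 0 ≤ β)
    (prior : Measure (Fin n → ℝ)) [SFinite prior] :
    plantedWishart n N β prior ≪ nullWishart n N := by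
  have hm := measurable_spikedSamples (n := n) (N := N) β
  refine Measure.AbsolutelyContinuous.mk fun s hs h0 => ?_
  rw [plantedWishart_eq_map hβ, Measure.map_apply hm hs, Measure.prod_apply (hm hs)]
  refine lintegral_eq_zero_of_ae_eq_zero (Eventually.of_forall fun x => ?_)
  have h := spikedWishart_absolutelyContinuous hβ x h0
  rw [spikedWishart_eq_map hβ, Measure.map_apply (by fun_prop) hs] at h
  exact h

/-! ### Moments of the samples under both laws -/

lemma HasAllMoments.map {Ω Ω' : Type*} [MeasurableSpace Ω] [MeasurableSpace Ω'] {μ : Measure Ω}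
    {φ : Ω → Ω'} {f : Ω' → ℝ} (hφ : Measurable φ) (hf : Measurable f)
    (h : HasAllMoments (fun ω => f (φ ω)) μ) : HasAllMoments f (μ.map φ) := fun p =>
  (memLp_map_measure_iff hf.aestronglyMeasurable hφ.aemeasurable).2 (h p)

lemma hasAllMoments_eval_pi {ι : Type*} [Fintype ι] {μ : ι → Measure ℝ}
    [∀ i, IsProbabilityMeasure (μ i)] (i : ι) (h : HasAllMoments (fun x => x) (μ i)) :
    HasAllMoments (fun z : ι → ℝ => z i) (Measure.pi μ) :=
  h.comp_measurePreserving (measurePreserving_eval μ i)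

lemma hasAllMoments_gaussianPi {n : ℕ} (i : Fin n) :
    HasAllMoments (fun z : Fin n → ℝ => z i) (gaussianPi n) :=
  hasAllMoments_eval_pi i hasAllMoments_gaussianReal

lemma hasAllMoments_nullWishart {n N : ℕ} (k : Fin N) (i : Fin n) :
    HasAllMoments (fun y : Samples n N => y k i) (nullWishart n N) := by
  rw [nullWishart_eq_map]
  refine HasAllMoments.map (by fun_prop) (by fun_prop) ?_
  exact (hasAllMoments_gaussianPi i).comp_measurePreserving
    (measurePreserving_eval (fun _ : Fin N => gaussianPi n) k)

lemma hasAllMoments_plantedWishart {n N : ℕ} {β : ℝ} (hβ : 0 ≤ β) {prior : Measure (Fin n → ℝ)}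
    [IsProbabilityMeasure prior] (hprior : ∀ i, HasAllMoments (fun x : Fin n → ℝ => x i) prior)
    (k : Fin N) (i : Fin n) :
    HasAllMoments (fun y : Samples n N => y k i) (plantedWishart n N β prior) := by
  rw [plantedWishart_eq_map hβ]
  refine HasAllMoments.map (measurable_spikedSamples β) (by fun_prop) ?_
  have hk : MeasurePreserving
      (fun ω : (Fin n → ℝ) × (Fin N → (Fin n → ℝ) × ℝ) => ω.2 k)
      (prior.prod (noiseLaw n N)) ((gaussianPi n).prod (gaussianReal 0 1)) :=
    (measurePreserving_eval (fun _ : Fin N => (gaussianPi n).prod (gaussianReal 0 1)) k).comp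
      measurePreserving_snd
  have h1 := (hasAllMoments_gaussianPi i).comp_measurePreserving (measurePreserving_fst.comp hk)
  have h2 := hasAllMoments_gaussianReal.comp_measurePreserving (measurePreserving_snd.comp hk)
  have h3 := (hprior i).comp_measurePreserving
    (measurePreserving_fst (μ := prior) (ν := noiseLaw n N))
  exact h1.add (((HasAllMoments.const √β).mul h2).mul h3)

/-! ### Hermite coefficients of the likelihood ratio -/

/-- Products of Hermite polynomials in the coordinates. -/
noncomputable def hermiteProd {σ : Type*} [Fintype σ] (α : σ → ℕ) : MvPolynomial σ ℝ :=
  ∏ s, Polynomial.aeval (MvPolynomial.X s) (realHermite (α s))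

lemma eval_hermiteProd {σ : Type*} [Fintype σ] (α : σ → ℕ) (z : σ → ℝ) :
    MvPolynomial.eval z (hermiteProd α) = ∏ s, (realHermite (α s)).eval (z s) := by
  rw [hermiteProd, map_prod]
  refine Finset.prod_congr rfl fun s _ => ?_
  rw [← MvPolynomial.coe_aeval_eq_eval, RingHom.coe_coe, ← Polynomial.aeval_algHom_apply]
  simp [Polynomial.aeval_def, Polynomial.eval₂_eq_eval_map]

lemma totalDegree_aeval_X_le {σ : Type*} (s : σ) (p : Polynomial ℝ) :
    (Polynomial.aeval (MvPolynomial.X s : MvPolynomial σ ℝ) p).totalDegree ≤ p.natDegree := by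
  rw [Polynomial.aeval_eq_sum_range]
  refine (MvPolynomial.totalDegree_finsetSum _ _).trans (Finset.sup_le fun i hi => ?_)
  refine (MvPolynomial.totalDegree_smul_le _ _).trans ?_
  rw [MvPolynomial.totalDegree_X_pow]
  exact Nat.lt_succ_iff.1 (Finset.mem_range.1 hi)

lemma totalDegree_hermiteProd_le {σ : Type*} [Fintype σ] (α : σ → ℕ) :
    (hermiteProd α).totalDegree ≤ ∑ s, α s := by
  refine (MvPolynomial.totalDegree_finsetProd _ _).trans (Finset.sum_le_sum fun s _ => ?_)
  exact (totalDegree_aeval_X_le s _).trans (natDegree_realHermite _).le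

lemma measurable_polyFun {n N : ℕ} (p : MvPolynomial (Fin N × Fin n) ℝ) :
    Measurable (polyFun p) := by
  unfold polyFun
  exact (MvPolynomial.continuous_eval p).measurable.comp (by fun_prop)

lemma integral_hermiteProd_mul_nullWishart {n N : ℕ} (α α' : Fin N × Fin n → ℕ) :
    ∫ y, polyFun (hermiteProd α) y * polyFun (hermiteProd α') y ∂(nullWishart n N) =
      if α = α' then ∏ s, ((α s).factorial : ℝ) else 0 := by
  have hm : Measurable fun y : Samples n N =>
      polyFun (hermiteProd α) y * polyFun (hermiteProd α') y :=
    (measurable_polyFun _).mul (measurable_polyFun _)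
  rw [nullWishart_eq_map, integral_map (Measurable.aemeasurable (by fun_prop)) hm.aestronglyMeasurable]
  simp only [polyFun, eval_hermiteProd, ← Finset.prod_mul_distrib, Fintype.prod_prod_type]
  rw [integral_fintype_prod_eq_prod (fun (k : Fin N) (z : Fin n → ℝ) =>
    ∏ i, (realHermite (α (k, i))).eval (z i) * (realHermite (α' (k, i))).eval (z i))]
  rw [Finset.prod_congr rfl fun k _ => integral_fintype_prod_eq_prod (fun (i : Fin n) (z : ℝ) =>
    (realHermite (α (k, i))).eval z * (realHermite (α' (k, i))).eval z)]
  simp_rw [integral_realHermite_mul_realHermite]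
  rw [← Fintype.prod_prod_type' (f := fun k i =>
    if α (k, i) = α' (k, i) then ((α (k, i)).factorial : ℝ) else 0)]
  split_ifs with h
  · simp [h, Fintype.prod_prod_type]
  · obtain ⟨s, hs⟩ := Function.ne_iff.1 h
    exact Finset.prod_eq_zero (Finset.mem_univ s) (if_neg hs)

/-- The rank-one signal. -/
noncomputable def signal {n N : ℕ} (β : ℝ) (s : Fin N × Fin n)
    (ω : (Fin n → ℝ) × (Fin N → ℝ)) : ℝ :=
  √β * ω.2 s.1 * ω.1 s.2

lemma hasAllMoments_signal {n N : ℕ} (β : ℝ) {prior : Measure (Fin n → ℝ)}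
    [IsProbabilityMeasure prior] (hprior : ∀ i, HasAllMoments (fun x : Fin n → ℝ => x i) prior)
    (s : Fin N × Fin n) : HasAllMoments (signal β s) (prior.prod (gaussianPi N)) :=
  ((HasAllMoments.const √β).mul ((hasAllMoments_gaussianPi s.1).comp_measurePreserving
    measurePreserving_snd)).mul ((hprior s.2).comp_measurePreserving measurePreserving_fst)

lemma HasAllMoments.prod_pow {Ω σ : Type*} [MeasurableSpace Ω] {μ : Measure Ω}
    [IsFiniteMeasure μ] [Fintype σ] {X : σ → Ω → ℝ} (hX : ∀ s, HasAllMoments (X s) μ)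
    (α : σ → ℕ) : HasAllMoments (fun ω => ∏ s, X s ω ^ α s) μ := by
  simpa using HasAllMoments.eval_mvPolynomial hX (∏ s, MvPolynomial.X s ^ α s)

lemma isProbabilityMeasure_plantedWishart {n N : ℕ} {β : ℝ} (hβ : 0 ≤ β)
    (prior : Measure (Fin n → ℝ)) [IsProbabilityMeasure prior] :
    IsProbabilityMeasure (plantedWishart n N β prior) := by
  rw [plantedWishart_eq_map hβ]
  exact Measure.isProbabilityMeasure_map (measurable_spikedSamples β).aemeasurable

/-- With the spike and the scalars fixed, the entries are independent Gaussians of unit variance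
whose means are the signal, so `integral_realHermite_add` applies to each entry. -/
lemma integral_hermiteProd_plantedWishart {n N : ℕ} {β : ℝ} (hβ : 0 ≤ β)
    {prior : Measure (Fin n → ℝ)} [IsProbabilityMeasure prior]
    (hprior : ∀ i, HasAllMoments (fun x : Fin n → ℝ => x i) prior) (α : Fin N × Fin n → ℕ) :
    ∫ y, polyFun (hermiteProd α) y ∂(plantedWishart n N β prior) =
      ∫ ω, ∏ s, signal β s ω ^ α s ∂(prior.prod (gaussianPi N)) := by
  have := isProbabilityMeasure_plantedWishart (N := N) hβ prior
  have hint := (hasAllMoments_polyFun (n := n) (N := N)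
    (fun k i => hasAllMoments_plantedWishart hβ hprior k i) (hermiteProd α))
  have hm := measurable_spikedSamples (n := n) (N := N) β
  rw [plantedWishart_eq_map hβ] at hint ⊢
  have hint' : Integrable (fun ω => polyFun (hermiteProd α) (spikedSamples β ω))
      (prior.prod (noiseLaw n N)) := (integrable_map_measure (measurable_polyFun _).aestronglyMeasurable
    hm.aemeasurable).1 hint.integrable
  rw [integral_map hm.aemeasurable (measurable_polyFun _).aestronglyMeasurable,
    integral_prod _ hint',
    integral_prod _ (HasAllMoments.prod_pow (hasAllMoments_signal β hprior) α).integrable]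
  congr 1 with x
  simp only [polyFun, eval_hermiteProd, Fintype.prod_prod_type, spikedSamples, spikedSample,
    signal]
  rw [integral_fintype_prod_eq_prod (fun (k : Fin N) (p : (Fin n → ℝ) × ℝ) =>
    ∏ i, (realHermite (α (k, i))).eval (p.1 i + √β * p.2 * x i)),
    integral_fintype_prod_eq_prod (fun (k : Fin N) (t : ℝ) => ∏ i, (√β * t * x i) ^ α (k, i))]
  refine Finset.prod_congr rfl fun k _ => ?_
  have hi : Integrable (fun p : (Fin n → ℝ) × ℝ =>
      ∏ i, (realHermite (α (k, i))).eval (p.1 i + √β * p.2 * x i))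
      ((gaussianPi n).prod (gaussianReal 0 1)) := by
    have := HasAllMoments.eval_mvPolynomial
      (μ := (gaussianPi n).prod (gaussianReal 0 1))
      (X := fun (i : Fin n) (p : (Fin n → ℝ) × ℝ) => p.1 i + √β * p.2 * x i)
      (fun i => ((hasAllMoments_gaussianPi i).comp_measurePreserving measurePreserving_fst).add
        (((HasAllMoments.const √β).mul (hasAllMoments_gaussianReal.comp_measurePreserving
          measurePreserving_snd)).mul (HasAllMoments.const (x i))))
      (hermiteProd fun i => α (k, i))
    simpa only [eval_hermiteProd] using this.integrable
  rw [integral_prod_symm _ hi]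
  congr 1 with t
  rw [integral_fintype_prod_eq_prod (fun (i : Fin n) (z : ℝ) =>
    (realHermite (α (k, i))).eval (z + √β * t * x i))]
  simp_rw [integral_realHermite_add]

/-! ### From Hermite coefficients to overlap moments -/

/-- The sum of the squares of the normalized mixed moments of degree `m` is a moment of the
overlap of two independent copies. -/
lemma sum_sq_integral_prod_pow {Ω σ : Type*} [MeasurableSpace Ω] {μ : Measure Ω}
    [IsFiniteMeasure μ] [Fintype σ] [DecidableEq σ] {X : σ → Ω → ℝ}
    (hX : ∀ s, HasAllMoments (X s) μ) (m : ℕ) :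
    ∫ ω, ∫ ω', (∑ s, X s ω * X s ω') ^ m ∂μ ∂μ =
      m.factorial * ∑ α ∈ Finset.univ.piAntidiag m,
        (∫ ω, ∏ s, X s ω ^ α s ∂μ) ^ 2 / ∏ s, ((α s).factorial : ℝ) := by
  have hi : ∀ α : σ → ℕ, Integrable (fun ω => ∏ s, X s ω ^ α s) μ := fun α =>
    (HasAllMoments.prod_pow hX α).integrable
  have hmul : ∀ α ∈ (Finset.univ : Finset σ).piAntidiag m,
      (Nat.multinomial Finset.univ α : ℝ) = m.factorial / ∏ s, ((α s).factorial : ℝ) := by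
    intro α hα
    have h := Nat.multinomial_spec Finset.univ α
    rw [(Finset.mem_piAntidiag.1 hα).1] at h
    rw [eq_div_iff (Finset.prod_ne_zero_iff.2 fun s _ => by positivity), mul_comm]
    exact_mod_cast h
  simp_rw [Finset.sum_pow_eq_sum_piAntidiag, mul_pow, Finset.prod_mul_distrib]
  have h1 : ∀ ω, ∫ ω', ∑ α ∈ (Finset.univ : Finset σ).piAntidiag m,
      (Nat.multinomial Finset.univ α : ℝ) * ((∏ s, X s ω ^ α s) * ∏ s, X s ω' ^ α s) ∂μ =
      ∑ α ∈ (Finset.univ : Finset σ).piAntidiag m, ((Nat.multinomial Finset.univ α : ℝ) *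
        ∫ ω', ∏ s, X s ω' ^ α s ∂μ) * ∏ s, X s ω ^ α s := fun ω => by
    rw [integral_finsetSum _ fun α _ => ((hi α).const_mul _).const_mul _]
    refine Finset.sum_congr rfl fun α _ => ?_
    rw [integral_const_mul, integral_const_mul]
    ring
  simp_rw [h1]
  rw [integral_finsetSum _ fun α _ => (hi α).const_mul _, Finset.mul_sum]
  refine Finset.sum_congr rfl fun α hα => ?_
  rw [integral_const_mul, hmul α hα]
  ring

/-- The signal is a rank-one matrix, so the overlap of two copies is `β ⟨x,x'⟩ ⟨g,g'⟩`, and spike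
and scalars are independent. -/
lemma integral_overlap_signal {n N : ℕ} {β : ℝ} (hβ : 0 ≤ β) (prior : Measure (Fin n → ℝ))
    [IsProbabilityMeasure prior] (m : ℕ) :
    ∫ ω, ∫ ω', (∑ s : Fin N × Fin n, signal β s ω * signal β s ω') ^ m
        ∂(prior.prod (gaussianPi N)) ∂(prior.prod (gaussianPi N)) =
      β ^ m * (∫ x, ∫ x', (∑ i, x i * x' i) ^ m ∂prior ∂prior) *
        ∫ g, ∫ g', (∑ k, g k * g' k) ^ m ∂(gaussianPi N) ∂(gaussianPi N) := by
  have h : ∀ ω ω' : (Fin n → ℝ) × (Fin N → ℝ),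
      (∑ s : Fin N × Fin n, signal β s ω * signal β s ω') ^ m =
        β ^ m * ((∑ i, ω.1 i * ω'.1 i) ^ m * (∑ k, ω.2 k * ω'.2 k) ^ m) := by
    intro ω ω'
    rw [← mul_pow, ← mul_pow]
    congr 1
    rw [mul_comm (∑ i, _), Fintype.sum_mul_sum, Fintype.sum_prod_type, Finset.mul_sum]
    refine Finset.sum_congr rfl fun k _ => ?_
    rw [Finset.mul_sum]
    refine Finset.sum_congr rfl fun i _ => ?_
    simp only [signal]
    calc _ = (√β * √β) * (ω.2 k * ω'.2 k * (ω.1 i * ω'.1 i)) := by ring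
      _ = _ := by rw [Real.mul_self_sqrt hβ]
  simp_rw [h, integral_const_mul]
  have h2 : ∀ ω : (Fin n → ℝ) × (Fin N → ℝ),
      ∫ ω' : (Fin n → ℝ) × (Fin N → ℝ),
        (∑ i, ω.1 i * ω'.1 i) ^ m * (∑ k, ω.2 k * ω'.2 k) ^ m ∂(prior.prod (gaussianPi N)) =
      (∫ x', (∑ i, ω.1 i * x' i) ^ m ∂prior) *
        ∫ g', (∑ k, ω.2 k * g' k) ^ m ∂(gaussianPi N) := fun ω =>
    integral_prod_mul (fun x' : Fin n → ℝ => (∑ i, ω.1 i * x' i) ^ m)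
      (fun g' : Fin N → ℝ => (∑ k, ω.2 k * g' k) ^ m)
  simp_rw [h2]
  rw [integral_prod_mul (fun x : Fin n → ℝ => ∫ x', (∑ i, x i * x' i) ^ m ∂prior)
    (fun g : Fin N → ℝ => ∫ g', (∑ k, g k * g' k) ^ m ∂(gaussianPi N))]
  ring

/-- A lower bound on the norm of the low-degree likelihood ratio by the moments of the overlap of
two independent spikes and of two independent Gaussian vectors. -/
theorem overlap_moment_le_sq_wishartLDLRNorm {n N D m : ℕ} {β : ℝ} (hβ : 0 ≤ β) (hm : m ≤ D)
    {prior : Measure (Fin n → ℝ)} [IsProbabilityMeasure prior]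
    (hprior : ∀ i, HasAllMoments (fun x : Fin n → ℝ => x i) prior) :
    β ^ m / m.factorial * (∫ x, ∫ x', (∑ i, x i * x' i) ^ m ∂prior ∂prior) *
        (∫ g, ∫ g', (∑ k, g k * g' k) ^ m ∂(gaussianPi N) ∂(gaussianPi N)) ≤
      wishartLDLRNorm n N β prior D ^ 2 := by
  classical
  set Q := nullWishart n N with hQ
  set P := plantedWishart n N β prior with hP
  have hPp : IsProbabilityMeasure P := isProbabilityMeasure_plantedWishart hβ prior
  have hac : P ≪ Q := plantedWishart_absolutelyContinuous hβ prior
  have hPpoly : ∀ q : MvPolynomial (Fin N × Fin n) ℝ, Integrable (polyFun q) P := fun q =>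
    (hasAllMoments_polyFun (fun k i => hasAllMoments_plantedWishart hβ hprior k i) q).integrable
  have hQpoly : ∀ p q : MvPolynomial (Fin N × Fin n) ℝ,
      Integrable (fun y => polyFun p y * polyFun q y) Q := fun p q =>
    ((hasAllMoments_polyFun hasAllMoments_nullWishart p).mul
      (hasAllMoments_polyFun hasAllMoments_nullWishart q)).integrable
  set c : (Fin N × Fin n → ℕ) → ℝ :=
    fun α => ∫ ω, ∏ s, signal β s ω ^ α s ∂(prior.prod (gaussianPi N)) with hc
  set F : (Fin N × Fin n → ℕ) → ℝ := fun α => ∏ s, ((α s).factorial : ℝ) with hF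
  have hFpos : ∀ α, 0 < F α := fun α => Finset.prod_pos fun s _ => by positivity
  set A := (Finset.univ : Finset (Fin N × Fin n)).piAntidiag m with hA
  -- The Hermite component of `L` of degree exactly `m`; being a projection of `L`, it satisfies the
  -- hypothesis `⟨L, g⟩ = ⟨g, g⟩` of the duality bound.
  set g : MvPolynomial (Fin N × Fin n) ℝ := ∑ α ∈ A, (c α / F α) • hermiteProd α with hg
  have hgdeg : g.totalDegree ≤ D := by
    refine (MvPolynomial.totalDegree_finsetSum _ _).trans (Finset.sup_le fun α hα => ?_)
    refine (MvPolynomial.totalDegree_smul_le _ _).trans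
      ((totalDegree_hermiteProd_le α).trans ?_)
    rw [(Finset.mem_piAntidiag.1 hα).1]
    exact hm
  have hgeval : ∀ y : Samples n N,
      polyFun g y = ∑ α ∈ A, c α / F α * polyFun (hermiteProd α) y := fun y => by
    simp [polyFun, hg, map_sum, MvPolynomial.smul_eval]
  have hPg : ∫ y, polyFun g y ∂P = ∑ α ∈ A, c α ^ 2 / F α := by
    simp_rw [hgeval]
    rw [integral_finsetSum _ fun α _ => (hPpoly _).const_mul _]
    refine Finset.sum_congr rfl fun α _ => ?_
    rw [integral_const_mul, hP, integral_hermiteProd_plantedWishart hβ hprior]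
    change c α / F α * c α = _
    ring
  have hQg : ∫ y, polyFun g y ^ 2 ∂Q = ∑ α ∈ A, c α ^ 2 / F α := by
    have h1 : ∀ y : Samples n N, polyFun g y ^ 2 = ∑ α ∈ A, ∑ α' ∈ A,
        (c α / F α * (c α' / F α')) *
          (polyFun (hermiteProd α) y * polyFun (hermiteProd α') y) := fun y => by
      rw [pow_two, hgeval, Finset.sum_mul_sum]
      exact Finset.sum_congr rfl fun α _ => Finset.sum_congr rfl fun α' _ => by ring
    simp_rw [h1]
    rw [integral_finsetSum _ fun α _ => integrable_finsetSum _ fun α' _ =>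
      (hQpoly _ _).const_mul _]
    refine Finset.sum_congr rfl fun α hα => ?_
    rw [integral_finsetSum _ fun α' _ => (hQpoly _ _).const_mul _]
    simp_rw [integral_const_mul, hQ, integral_hermiteProd_mul_nullWishart]
    rw [Finset.sum_eq_single α (fun α' _ h => by simp [Ne.symm h]) (fun h => absurd hα h),
      if_pos rfl]
    change c α / F α * (c α / F α) * F α = _
    have := (hFpos α).ne'
    field_simp
  have hLint : ∀ q : MvPolynomial (Fin N × Fin n) ℝ,
      Integrable (fun y => wishartLikelihoodRatio n N β prior y * polyFun q y) Q := fun q =>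
    (integrable_rnDeriv_smul_iff hac).2 (hPpoly q)
  have hLg : ∫ y, wishartLikelihoodRatio n N β prior y * polyFun g y ∂Q =
      ∫ y, polyFun g y ^ 2 ∂Q := by
    rw [hQg, ← hPg]
    exact integral_rnDeriv_smul hac
  have key := integral_sq_le_integral_lowDegreePart_sq hasAllMoments_nullWishart hLint hgdeg hLg
  have hT := sum_sq_integral_prod_pow (hasAllMoments_signal (N := N) β hprior) m
  rw [integral_overlap_signal hβ] at hT
  have hm0 : (m.factorial : ℝ) ≠ 0 := by positivity
  rw [wishartLDLRNorm, Real.sq_sqrt (integral_nonneg fun y => sq_nonneg _)]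
  refine le_of_eq_of_le ?_ key
  rw [hQg, ← mul_right_inj' hm0, ← hT]
  field_simp

/-! ### Lower bounds on overlap moments -/

/-- The moments of the overlap of two independent vectors with i.i.d. entries. -/
lemma integral_overlap_pi {ι : Type*} [Fintype ι] [DecidableEq ι] {μ : Measure ℝ}
    [IsProbabilityMeasure μ] (hμ : HasAllMoments (fun x => x) μ) (m : ℕ) :
    ∫ x, ∫ x', (∑ i : ι, x i * x' i) ^ m ∂(Measure.pi fun _ => μ) ∂(Measure.pi fun _ => μ) =
      m.factorial * ∑ α ∈ (Finset.univ : Finset ι).piAntidiag m,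
        ∏ i, ((∫ x, x ^ α i ∂μ) ^ 2 / (α i).factorial) := by
  rw [sum_sq_integral_prod_pow (X := fun i (x : ι → ℝ) => x i)
    (fun i => hasAllMoments_eval_pi (μ := fun _ => μ) i hμ)]
  congr 1
  refine Finset.sum_congr rfl fun α _ => ?_
  rw [integral_fintype_prod_eq_prod (fun i x => x ^ α i), Finset.prod_div_distrib,
    Finset.prod_pow]

lemma two_pow_mul_factorial_le (k : ℕ) : 2 ^ k * k.factorial ≤ (2 * k).factorial := by
  induction k with
  | zero => simp
  | succ k ih =>
    rw [show 2 * (k + 1) = 2 * k + 1 + 1 by ring, Nat.factorial_succ, Nat.factorial_succ,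
      Nat.factorial_succ, pow_succ]
    calc 2 ^ k * 2 * ((k + 1) * k.factorial) = (2 * k + 1 + 1) * (1 * (2 ^ k * k.factorial)) := by
          ring
      _ ≤ _ := by gcongr; omega

/-- Only the even multi-indices `2κ` are kept. Each factor `(2κ)! / (2^κ κ!)²` is at least `1 / (2^κ
κ!)` by `two_pow_mul_factorial_le`, and the multinomial theorem sums these bounds exactly. -/
lemma le_integral_overlap_gaussianPi (N d : ℕ) :
    ((2 * d).factorial : ℝ) * (N ^ d / (2 ^ d * d.factorial)) ≤
      ∫ g, ∫ g', (∑ k, g k * g' k) ^ (2 * d) ∂(gaussianPi N) ∂(gaussianPi N) := by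
  classical
  rw [integral_overlap_pi hasAllMoments_gaussianReal]
  refine mul_le_mul_of_nonneg_left ?_ (by positivity)
  have hinj : Function.Injective fun (κ : Fin N → ℕ) i => 2 * κ i := fun κ κ' h => by
    ext i
    have := congrFun h i
    simpa using this
  calc (N : ℝ) ^ d / (2 ^ d * d.factorial)
      = ∑ κ ∈ (Finset.univ : Finset (Fin N)).piAntidiag d,
          ∏ i, 1 / (2 ^ κ i * (κ i).factorial : ℝ) := by
        have h := Finset.sum_pow_eq_sum_piAntidiag (Finset.univ : Finset (Fin N))
          (fun _ => (1 : ℝ)) d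
        simp only [Finset.sum_const, Finset.card_univ, Fintype.card_fin, nsmul_eq_mul, mul_one,
          one_pow, Finset.prod_const_one] at h
        rw [h, Finset.sum_div]
        refine Finset.sum_congr rfl fun κ hκ => ?_
        have h1 := (Finset.mem_piAntidiag.1 hκ).1
        have h2 := Nat.multinomial_spec Finset.univ κ
        rw [h1] at h2
        have h3 : (∏ i, ((κ i).factorial : ℝ)) * Nat.multinomial Finset.univ κ = d.factorial := by
          exact_mod_cast h2
        rw [Finset.prod_div_distrib, Finset.prod_mul_distrib, Finset.prod_pow_eq_pow_sum, h1,
          ← h3, Finset.prod_const_one]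
        have h4 : (Nat.multinomial Finset.univ κ : ℝ) ≠ 0 := by
          intro h0
          rw [h0, mul_zero] at h3
          exact (Nat.cast_ne_zero.2 d.factorial_ne_zero) h3.symm
        have h5 : (∏ i, ((κ i).factorial : ℝ)) ≠ 0 :=
          Finset.prod_ne_zero_iff.2 fun i _ => by positivity
        field_simp
    _ ≤ ∑ κ ∈ (Finset.univ : Finset (Fin N)).piAntidiag d,
          ∏ i, ((∫ x, x ^ (2 * κ i) ∂(gaussianReal 0 1)) ^ 2 / (2 * κ i).factorial) := by
        refine Finset.sum_le_sum fun κ _ => Finset.prod_le_prod (fun i _ => by positivity)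
          fun i _ => ?_
        rw [integral_pow_two_mul_gaussianReal]
        have h := two_pow_mul_factorial_le (κ i)
        have h' : (2 ^ κ i * (κ i).factorial : ℝ) ≤ (2 * κ i).factorial := by exact_mod_cast h
        have hp : (0 : ℝ) < 2 ^ κ i * (κ i).factorial := by positivity
        have hq : (0 : ℝ) < (2 * κ i).factorial := by positivity
        generalize (2 ^ κ i * (κ i).factorial : ℝ) = a at *
        generalize ((2 * κ i).factorial : ℝ) = b at *
        rw [div_pow, div_div, div_le_div_iff₀ hp (by positivity)]
        nlinarith [mul_le_mul_of_nonneg_left h' (mul_pos hp hq).le]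
    _ = ∑ α ∈ ((Finset.univ : Finset (Fin N)).piAntidiag d).image (fun κ i => 2 * κ i),
          ∏ i, ((∫ x, x ^ α i ∂(gaussianReal 0 1)) ^ 2 / (α i).factorial) := by
        rw [Finset.sum_image hinj.injOn]
    _ ≤ _ := by
        refine Finset.sum_le_sum_of_subset_of_nonneg ?_ fun α _ _ =>
          Finset.prod_nonneg fun i _ => by positivity
        intro α hα
        obtain ⟨κ, hκ, rfl⟩ := Finset.mem_image.1 hα
        rw [Finset.mem_piAntidiag] at hκ ⊢
        exact ⟨by rw [← Finset.mul_sum, hκ.1], fun _ _ => Finset.mem_univ _⟩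

/-- All terms of the expansion are nonnegative; those kept are the multi-indices equal to `m` on a
`k`-subset and `0` elsewhere. -/
lemma le_integral_overlap_pi_of_sparse {n : ℕ} {μ : Measure ℝ} [IsProbabilityMeasure μ]
    (hμ : HasAllMoments (fun x => x) μ) {m : ℕ} (hm : m ≠ 0) (k : ℕ) :
    ((k * m).factorial : ℝ) * (n.choose k * ((∫ x, x ^ m ∂μ) ^ 2 / m.factorial) ^ k) ≤
      ∫ x, ∫ x', (∑ i : Fin n, x i * x' i) ^ (k * m)
        ∂(Measure.pi fun _ => μ) ∂(Measure.pi fun _ => μ) := by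
  classical
  rw [integral_overlap_pi hμ]
  refine mul_le_mul_of_nonneg_left ?_ (by positivity)
  set φ : Finset (Fin n) → Fin n → ℕ := fun S i => if i ∈ S then m else 0 with hφ
  have hinj : Function.Injective φ := fun S S' h => by
    ext i
    have := congrFun h i
    simp only [hφ] at this
    by_cases h1 : i ∈ S <;> by_cases h2 : i ∈ S' <;> simp_all
  calc (n.choose k * ((∫ x, x ^ m ∂μ) ^ 2 / m.factorial) ^ k : ℝ)
      = ∑ S ∈ (Finset.univ : Finset (Fin n)).powersetCard k,
          ∏ i, ((∫ x, x ^ φ S i ∂μ) ^ 2 / (φ S i).factorial) := by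
        rw [Finset.sum_congr rfl (g := fun _ => ((∫ x, x ^ m ∂μ) ^ 2 / m.factorial) ^ k)]
        · simp
        · intro S hS
          have h : ∀ i, (∫ x, x ^ φ S i ∂μ) ^ 2 / ((φ S i).factorial : ℝ) =
              if i ∈ S then (∫ x, x ^ m ∂μ) ^ 2 / m.factorial else 1 := fun i => by
            simp only [hφ]
            split_ifs <;> simp
          simp_rw [h]
          rw [Finset.prod_ite_mem, Finset.univ_inter, Finset.prod_const,
            (Finset.mem_powersetCard.1 hS).2]
    _ = ∑ α ∈ ((Finset.univ : Finset (Fin n)).powersetCard k).image φ,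
          ∏ i, ((∫ x, x ^ α i ∂μ) ^ 2 / (α i).factorial) := by
        rw [Finset.sum_image hinj.injOn]
    _ ≤ _ := by
        refine Finset.sum_le_sum_of_subset_of_nonneg ?_ fun α _ _ =>
          Finset.prod_nonneg fun i _ => by positivity
        intro α hα
        obtain ⟨S, hS, rfl⟩ := Finset.mem_image.1 hα
        rw [Finset.mem_piAntidiag]
        refine ⟨?_, fun _ _ => Finset.mem_univ _⟩
        simp only [hφ]
        rw [Finset.sum_ite_mem, Finset.univ_inter, Finset.sum_const,
          (Finset.mem_powersetCard.1 hS).2, smul_eq_mul]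

/-! ### Moments of the sparse Rademacher entry, and the explicit lower bound -/

section Entry

variable {n : ℕ} {ρ : ℝ}

lemma isProbabilityMeasure_sparseRademacherEntry (h0 : 0 ≤ ρ) (h1 : ρ ≤ 1) :
    IsProbabilityMeasure (sparseRademacherEntry n ρ) := by
  constructor
  simp only [sparseRademacherEntry, Measure.coe_add, Measure.coe_smul, Pi.add_apply,
    Pi.smul_apply, measure_univ, smul_eq_mul, mul_one]
  rw [← ENNReal.ofReal_add (by positivity) (by positivity),
    ← ENNReal.ofReal_add (by positivity) (by linarith)]
  simp

lemma hasAllMoments_sparseRademacherEntry (h0 : 0 ≤ ρ) (h1 : ρ ≤ 1) :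
    HasAllMoments (fun x => x) (sparseRademacherEntry n ρ) := fun p => by
  have := isProbabilityMeasure_sparseRademacherEntry (n := n) h0 h1
  refine MemLp.of_bound (by fun_prop) (1 / √(ρ * n)) ?_
  rw [sparseRademacherEntry, ae_add_measure_iff, ae_add_measure_iff]
  refine ⟨⟨Measure.ae_smul_measure ?_ _, Measure.ae_smul_measure ?_ _⟩,
    Measure.ae_smul_measure ?_ _⟩ <;> rw [ae_dirac_eq, eventually_pure]
  · rw [Real.norm_of_nonneg (by positivity)]
  · rw [norm_neg, Real.norm_of_nonneg (by positivity)]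
  · rw [norm_zero]
    positivity

lemma integral_pow_sparseRademacherEntry (h0 : 0 ≤ ρ) {m : ℕ} (hm : m ≠ 0) :
    ∫ x, x ^ (2 * m) ∂(sparseRademacherEntry n ρ) = ρ * (1 / (ρ * n)) ^ m := by
  have hi : ∀ (c a : ℝ), Integrable (fun x : ℝ => x ^ (2 * m))
      (ENNReal.ofReal c • Measure.dirac a) := fun c a =>
    (integrable_dirac (by simp)).smul_measure ENNReal.ofReal_ne_top
  rw [sparseRademacherEntry, integral_add_measure ((hi _ _).add_measure (hi _ _)) (hi _ _),
    integral_add_measure (hi _ _) (hi _ _)]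
  simp only [integral_smul_measure, integral_dirac, smul_eq_mul]
  rw [ENNReal.toReal_ofReal (by positivity), pow_mul, pow_mul, neg_sq, div_pow,
    Real.sq_sqrt (by positivity)]
  simp [hm]
  ring

end Entry

/-- A lower bound on the norm of the low-degree likelihood ratio: the contribution of the spike
moments supported on `k` coordinates, with multiplicity `2 * m` each. -/
theorem le_sq_wishartLDLRNorm {n N D k m : ℕ} {β ρ : ℝ} (hn : 1 ≤ n) (hN : 1 ≤ N) (hβ : 0 ≤ β)
    (hρ0 : 0 < ρ) (hρ1 : ρ ≤ 1) (hm : m ≠ 0) (hD : 2 * (k * m) ≤ D) :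
    wishartSNR n N β ^ (2 * (k * m)) * n ^ (k * m) *
        ((2 * (k * m)).factorial / (2 ^ (k * m) * (k * m).factorial)) *
        (n.choose k * (ρ ^ 2 / ((ρ * n) ^ (2 * m) * (2 * m).factorial)) ^ k) ≤
      wishartLDLRNorm n N β (sparseRademacherPrior n ρ) D ^ 2 := by
  have hE := isProbabilityMeasure_sparseRademacherEntry (n := n) hρ0.le hρ1
  have hM := hasAllMoments_sparseRademacherEntry (n := n) hρ0.le hρ1
  have hprob : IsProbabilityMeasure (sparseRademacherPrior n ρ) := by
    unfold sparseRademacherPrior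
    infer_instance
  refine le_trans ?_ (overlap_moment_le_sq_wishartLDLRNorm (m := 2 * (k * m)) hβ hD
    (prior := sparseRademacherPrior n ρ)
    (fun i => hasAllMoments_eval_pi (μ := fun _ => sparseRademacherEntry n ρ) i hM))
  have h1 := le_integral_overlap_gaussianPi N (k * m)
  have h2 := le_integral_overlap_pi_of_sparse (n := n) hM (m := 2 * m) (by omega) k
  rw [integral_pow_sparseRademacherEntry hρ0.le hm, show k * (2 * m) = 2 * (k * m) by ring] at h2
  have hnn : (0 : ℝ) < n := by exact_mod_cast hn
  have hNN : (0 : ℝ) < N := by exact_mod_cast hN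
  -- By definition `snr² * n = β² * N`, which trades `β` and `N` for the signal-to-noise ratio.
  have hsnr : wishartSNR n N β ^ (2 * (k * m)) * n ^ (k * m) = β ^ (2 * (k * m)) * N ^ (k * m) := by
    rw [wishartSNR, div_pow, pow_mul √_, Real.sq_sqrt (by positivity), div_pow]
    field_simp
  rw [hsnr]
  calc _ = β ^ (2 * (k * m)) / (2 * (k * m)).factorial *
        ((2 * (k * m)).factorial *
          (n.choose k * ((ρ * (1 / (ρ * n)) ^ m) ^ 2 / (2 * m).factorial) ^ k)) *
        ((2 * (k * m)).factorial * (N ^ (k * m) / (2 ^ (k * m) * (k * m).factorial))) := by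
        have : (ρ * (1 / (ρ * n)) ^ m) ^ 2 = ρ ^ 2 / (ρ * n) ^ (2 * m) := by
          rw [mul_pow, div_pow, one_pow, div_pow, one_pow, ← pow_mul, mul_comm m 2]
          ring
        rw [this, div_div]
        have hf : ((2 * (k * m)).factorial : ℝ) ≠ 0 := by positivity
        field_simp
    _ ≤ _ := by
        refine mul_le_mul (mul_le_mul_of_nonneg_left h2 (by positivity)) h1 (by positivity) ?_
        refine mul_nonneg (by positivity) (le_trans (by positivity) h2)

/-! ### The bound above the threshold -/

lemma wishartSNR_nonneg {n N : ℕ} {β : ℝ} (hβ : 0 ≤ β) : 0 ≤ wishartSNR n N β :=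
  div_nonneg hβ (Real.sqrt_nonneg _)

/-- Multiplicity `2` on each of `d` coordinates involves only the second moment `1/n` of an entry,
so `ρ` drops out. What is left is `snr^(2d)` times `n.descFactorial d / n^d` and `d.centralBinom /
4^d`, the latter at least `1 / (2d)`. -/
lemma le_sq_wishartLDLRNorm_of_snr {n N D d : ℕ} {β ρ : ℝ} (hN : 1 ≤ N) (hβ : 0 ≤ β)
    (hρ0 : 0 < ρ) (hρ1 : ρ ≤ 1) (hd : 0 < d) (hdn : d ≤ n) (hD : 2 * d ≤ D) :
    wishartSNR n N β ^ (2 * d) * (1 - d / n) ^ d / (2 * d) ≤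
      wishartLDLRNorm n N β (sparseRademacherPrior n ρ) D ^ 2 := by
  have h := le_sq_wishartLDLRNorm (k := d) (m := 1) (n := n) (by omega) hN hβ hρ0 hρ1 one_ne_zero
    (by simpa using hD)
  refine le_trans ?_ h
  have hn : (0 : ℝ) < n := by exact_mod_cast (by omega : 0 < n)
  have hd' : (0 : ℝ) < d := by exact_mod_cast hd
  have hcb : ((2 * d).factorial : ℝ) = d.centralBinom * d.factorial * d.factorial := by
    have h1 := Nat.choose_mul_factorial_mul_factorial (show d ≤ 2 * d by omega)
    rw [show 2 * d - d = d by omega] at h1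
    rw [Nat.centralBinom]
    exact_mod_cast h1.symm
  have hcb2 : (4 : ℝ) ^ d ≤ 2 * d * d.centralBinom := by
    exact_mod_cast Nat.four_pow_le_two_mul_self_mul_centralBinom d hd
  have hdesc : (n.descFactorial d : ℝ) = d.factorial * n.choose d := by
    exact_mod_cast Nat.descFactorial_eq_factorial_mul_choose n d
  have hdesc2 : ((n : ℝ) - d) ^ d ≤ n.descFactorial d := by
    have h1 : ((n - d : ℕ) : ℝ) ^ d ≤ n.descFactorial d := by
      exact_mod_cast (Nat.pow_le_pow_left (by omega) d).trans (Nat.pow_sub_le_descFactorial n d)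
    rwa [Nat.cast_sub hdn] at h1
  have hnd : (0 : ℝ) ≤ (n : ℝ) - d := sub_nonneg.2 (by exact_mod_cast hdn)
  simp only [mul_one]
  rw [hcb, Nat.factorial_two]
  calc wishartSNR n N β ^ (2 * d) * (1 - d / n) ^ d / (2 * d)
      = wishartSNR n N β ^ (2 * d) * ((((n : ℝ) - d) ^ d / n ^ d) * (4 ^ d / (2 * d) / 4 ^ d)) := by
        rw [one_sub_div hn.ne', div_pow]
        field_simp
    _ ≤ wishartSNR n N β ^ (2 * d) *
          ((n.descFactorial d / n ^ d) * (d.centralBinom / 4 ^ d)) := by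
        have h1 : (4 : ℝ) ^ d / (2 * d) ≤ d.centralBinom := by
          rw [div_le_iff₀ (by positivity)]
          linarith
        have := pow_nonneg (wishartSNR_nonneg (n := n) (N := N) hβ) (2 * d)
        gcongr
    _ = _ := by
        rw [hdesc]
        have h4 : (4 : ℝ) ^ d = 2 ^ d * 2 ^ d := by rw [← mul_pow]; norm_num
        have h5 : ρ ^ 2 / ((ρ * n) ^ 2 * ((2 : ℕ) : ℝ)) = 1 / (n ^ 2 * 2) := by
          push_cast
          field_simp
        have h6 : (n : ℝ) ^ (2 * d) = n ^ d * n ^ d := by rw [two_mul, pow_add]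
        rw [h4, h5, div_pow, mul_pow, one_pow, ← pow_mul, h6]
        field_simp

/-! ### The bound for sparse spikes -/

/-- The elementary inequality behind the choice of the multiplicity of the coordinates of the
spike. -/
lemma two_pow_le_of_sparse {n d m k : ℕ} {s ρ L : ℝ} (hn : 0 < n) (hk : 0 < k) (hm : 2 ≤ m)
    (hd : d = k * m) (hs : 0 < s) (hsL : Real.exp (-L) ≤ s) (hL : 1 ≤ L) (hLm : L ≤ m)
    (hmL : (m : ℝ) ≤ 3 * L) (hρ : 0 < ρ)
    (hρs : ρ < 1 / 5000 * s / L ^ 2 * √((4 * d : ℝ) / n)) :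
    2 ^ m ≤ s ^ (2 * m) * n ^ m * (d / 2) ^ m * (n / (2 * k)) *
      (ρ ^ 2 / ((ρ * n) ^ (2 * m) * (2 * m) ^ (2 * m))) := by
  have hn' : (0 : ℝ) < n := by exact_mod_cast hn
  have hk' : (0 : ℝ) < k := by exact_mod_cast hk
  have hm' : (0 : ℝ) < m := by exact_mod_cast (by omega : 0 < m)
  have hd' : (d : ℝ) = k * m := by rw [hd]; push_cast; ring
  have hd0 : (0 : ℝ) < d := by rw [hd']; positivity
  have hL0 : 0 < L := by linarith
  set A : ℝ := s ^ 2 * d / (8 * ρ ^ 2 * n * m ^ 2) with hA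
  -- Since `m² ≤ 9L⁴`, the sparsity bound gives `A > 5000² / (4 * 8 * 9)`, which exceeds `256²`;
  -- this fixes the constant `1/5000`.
  have hAbig : 256 ^ 2 ≤ A := by
    have h1 : ρ ^ 2 < (1 / 5000 * s / L ^ 2) ^ 2 * ((4 * d : ℝ) / n) := by
      have := pow_lt_pow_left₀ hρs hρ.le two_ne_zero
      rwa [mul_pow, Real.sq_sqrt (by positivity)] at this
    have h2 : ρ ^ 2 * n * L ^ 4 * 5000 ^ 2 < s ^ 2 * (4 * d) := by
      have h3 : (1 / 5000 * s / L ^ 2) ^ 2 * ((4 * d : ℝ) / n) =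
          s ^ 2 * (4 * d) / (n * L ^ 4 * 5000 ^ 2) := by
        field_simp
      rw [h3, lt_div_iff₀ (by positivity)] at h1
      linarith
    have h4 : (m : ℝ) ^ 2 ≤ 9 * L ^ 4 := by
      calc (m : ℝ) ^ 2 ≤ (3 * L) ^ 2 := by gcongr
        _ = 9 * (L ^ 2 * 1) := by ring
        _ ≤ 9 * (L ^ 2 * L ^ 2) := by gcongr; nlinarith
        _ = 9 * L ^ 4 := by ring
    rw [hA, le_div_iff₀ (by positivity)]
    have h5 : ρ ^ 2 * n * m ^ 2 ≤ ρ ^ 2 * n * (9 * L ^ 4) := by gcongr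
    nlinarith [mul_pos (mul_pos (pow_pos hρ 2) hn') (pow_pos hL0 4)]
  -- From `s ≥ exp (-L) ≥ exp (-m)` and `exp 2 ≤ 8`.
  have hs2 : ((1 : ℝ) / 8) ^ m ≤ s ^ 2 := by
    have he : Real.exp (2 : ℝ) ≤ 8 := by
      have : Real.exp (2 : ℝ) = Real.exp 1 ^ 2 := by rw [← Real.exp_nat_mul]; norm_num
      rw [this]
      nlinarith [Real.exp_one_lt_d9, Real.exp_pos 1]
    calc ((1 : ℝ) / 8) ^ m ≤ (Real.exp (-2)) ^ m := by
          gcongr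
          rw [Real.exp_neg, one_div]
          exact inv_anti₀ (Real.exp_pos _) he
      _ = Real.exp (-m) ^ 2 := by
          rw [← Real.exp_nat_mul, ← Real.exp_nat_mul]
          congr 1
          push_cast
          ring
      _ ≤ Real.exp (-L) ^ 2 := by gcongr
      _ ≤ s ^ 2 := by gcongr
  have hm2 : (m : ℝ) ≤ 2 ^ m := by exact_mod_cast Nat.lt_two_pow_self.le
  -- The left side is `A^m * (nρ²/(2k))`. One factor `A` absorbs the small factor `nρ²/(2k)`: with
  -- `d = km`, their product is `s²/(16m)`, free of `ρ`, `n` and `k`.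
  have key : s ^ (2 * m) * n ^ m * (d / 2) ^ m * (n / (2 * k)) *
      (ρ ^ 2 / ((ρ * n) ^ (2 * m) * (2 * m) ^ (2 * m))) = s ^ 2 / (16 * m) * A ^ (m - 1) := by
    have h1 : s ^ (2 * m) * n ^ m * (d / 2) ^ m * (n / (2 * k)) *
      (ρ ^ 2 / ((ρ * n) ^ (2 * m) * (2 * m) ^ (2 * m))) = A ^ m * (n * ρ ^ 2 / (2 * k)) := by
      have : A = s ^ 2 * n * (d / 2) / ((ρ * n) ^ 2 * (2 * m) ^ 2) := by
        rw [hA]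
        field_simp
        ring
      rw [this]
      simp only [div_pow, mul_pow, ← pow_mul]
      field_simp
    obtain ⟨j, rfl⟩ : ∃ j, m = j + 1 := ⟨m - 1, by omega⟩
    rw [h1, pow_succ, Nat.add_sub_cancel, mul_assoc, mul_comm (A ^ j)]
    congr 1
    rw [hA, hd']
    field_simp
    ring
  rw [key]
  calc (2 : ℝ) ^ m = (1 / 8) ^ m / (16 * 2 ^ m) * (16 * 2 ^ m * 2 ^ m * 8 ^ m) := by
        have : (8 : ℝ) ^ m * (1 / 8) ^ m = 1 := by rw [← mul_pow]; norm_num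
        field_simp
        rw [mul_comm, ← mul_pow]
        norm_num
    _ ≤ s ^ 2 / (16 * m) * (256 ^ 2) ^ (m - 1) := by
        gcongr ?_ / (16 * ?_) * ?_
        calc (16 : ℝ) * 2 ^ m * 2 ^ m * 8 ^ m = 2 ^ (5 * m + 4) := by
              have : (8 : ℝ) ^ m = 2 ^ (3 * m) := by rw [pow_mul]; norm_num
              rw [this, show (16 : ℝ) = 2 ^ 4 by norm_num, ← pow_add, ← pow_add, ← pow_add]
              congr 1
              ring
          -- The exponents compare because `m ≥ 2`; for `m = 1` no power of `A` would remain.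
          _ ≤ 2 ^ (16 * (m - 1)) := pow_le_pow_right₀ (by norm_num) (by omega)
          _ = (256 ^ 2) ^ (m - 1) := by rw [pow_mul]; norm_num
    _ ≤ s ^ 2 / (16 * m) * A ^ (m - 1) := by gcongr

/-- The `k`-th power of `two_pow_le_of_sparse`, once the factorials and the binomial coefficient of
the explicit bound are replaced by powers. -/
lemma two_pow_le_sq_wishartLDLRNorm_of_sparse {n N D k m : ℕ} {β ρ L : ℝ} (hN : 1 ≤ N)
    (hβ : 0 ≤ β) (hρ0 : 0 < ρ) (hρ1 : ρ ≤ 1) (hk : 0 < k) (hm : 2 ≤ m) (hD : 2 * (k * m) ≤ D)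
    (hD4 : D ≤ 4 * (k * m)) (hDn : D ≤ n) (hs : 0 < wishartSNR n N β)
    (hsL : Real.exp (-L) ≤ wishartSNR n N β) (hL : 1 ≤ L) (hLm : L ≤ m) (hmL : (m : ℝ) ≤ 3 * L)
    (hρs : ρ < 1 / 5000 * wishartSNR n N β / L ^ 2 * √((D : ℝ) / n)) :
    2 ^ (k * m) ≤ wishartLDLRNorm n N β (sparseRademacherPrior n ρ) D ^ 2 := by
  have hkm : 2 * k ≤ k * m := by nlinarith
  have hn : 0 < n := by omega
  have hn' : (0 : ℝ) < n := by exact_mod_cast hn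
  have hk' : (0 : ℝ) < k := by exact_mod_cast hk
  refine le_trans ?_ (le_sq_wishartLDLRNorm (k := k) (m := m) hn hN hβ hρ0 hρ1 (by omega) hD)
  set d := k * m with hd
  set s := wishartSNR n N β
  have hD4' : (D : ℝ) ≤ 4 * d := by exact_mod_cast hD4
  have hρs' : ρ < 1 / 5000 * s / L ^ 2 * √((4 * d : ℝ) / n) :=
    hρs.trans_le (by gcongr)
  have h := two_pow_le_of_sparse hn hk hm hd hs hsL hL hLm hmL hρ0 hρs'
  have hpow := pow_le_pow_left₀ (by positivity) h k
  rw [← pow_mul, mul_comm m k, ← hd] at hpow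
  refine hpow.trans ?_
  -- The last `d` factors of `(2d)!` all exceed `d`.
  have e1 : ((d : ℝ) / 2) ^ d ≤ (2 * d).factorial / (2 ^ d * d.factorial) := by
    have h1 : (d.factorial : ℝ) * d ^ d ≤ (2 * d).factorial := by
      have h2 := (Nat.mul_le_mul_left d.factorial (Nat.pow_le_pow_left (Nat.le_succ d) d)).trans
        (Nat.factorial_mul_pow_le_factorial (m := d) (n := d))
      rw [← two_mul] at h2
      exact_mod_cast h2
    rw [div_pow, div_le_div_iff₀ (by positivity) (by positivity)]
    nlinarith [pow_pos (two_pos : (0 : ℝ) < 2) d]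
  -- Since `2k ≤ n`, each of the `k` factors in the numerator of `n.choose k` is at least `n/2`,
  -- while `k! ≤ k^k`.
  have e2 : ((n : ℝ) / (2 * k)) ^ k ≤ n.choose k := by
    refine le_trans ?_ (Nat.pow_le_choose (α := ℝ) k n)
    have h1 : (n : ℝ) / 2 ≤ ((n + 1 - k : ℕ) : ℝ) := by
      rw [Nat.cast_sub (by omega)]
      have : (2 * k : ℝ) ≤ n := by exact_mod_cast (by omega : 2 * k ≤ n)
      push_cast
      linarith
    have h2 : (k.factorial : ℝ) ≤ k ^ k := by exact_mod_cast Nat.factorial_le_pow k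
    rw [← div_div, div_pow]
    gcongr
  have e3 : ((2 * m).factorial : ℝ) ≤ (2 * m) ^ (2 * m) := by
    exact_mod_cast Nat.factorial_le_pow (2 * m)
  have e4 : (ρ ^ 2 / ((ρ * n) ^ (2 * m) * (2 * m : ℝ) ^ (2 * m))) ^ k ≤
      (ρ ^ 2 / ((ρ * n) ^ (2 * m) * (2 * m).factorial)) ^ k := by gcongr
  calc _ = s ^ (2 * d) * n ^ d * ((d : ℝ) / 2) ^ d * (((n : ℝ) / (2 * k)) ^ k *
        (ρ ^ 2 / ((ρ * n) ^ (2 * m) * (2 * m : ℝ) ^ (2 * m))) ^ k) := by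
        rw [mul_pow, mul_pow, mul_pow, mul_pow, ← pow_mul, ← pow_mul, ← pow_mul,
          show 2 * m * k = 2 * d by rw [hd]; ring, show m * k = d by rw [hd]; ring]
        ring
    _ ≤ _ := by gcongr

/-! ### Asymptotics and the theorem -/

lemma tendsto_atTop_of_le_sq {f g : ℕ → ℝ} (hf : Tendsto f atTop atTop) (hg : ∀ n, 0 ≤ g n)
    (h : ∀ᶠ n in atTop, f n ≤ g n ^ 2) : Tendsto g atTop atTop :=
  tendsto_atTop_mono' _ (h.mono fun n hn => (Real.sqrt_le_left (hg n)).2 hn)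
    (Real.tendsto_sqrt_atTop.comp hf)

lemma wishartLDLRNorm_nonneg {n N D : ℕ} {β : ℝ} {prior : Measure (Fin n → ℝ)} :
    0 ≤ wishartLDLRNorm n N β prior D := Real.sqrt_nonneg _

lemma tendsto_pow_div_two_mul_atTop {r : ℝ} (hr : 1 < r) :
    Tendsto (fun d : ℕ => r ^ d / (2 * d)) atTop atTop := by
  have h := (tendsto_pow_const_div_const_pow_of_one_lt 1 hr).const_mul 2
  rw [mul_zero] at h
  have h2 : Tendsto (fun d : ℕ => 2 * ((d : ℝ) ^ 1 / r ^ d)) atTop (𝓝[>] 0) :=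
    tendsto_nhdsWithin_iff.2 ⟨h, (eventually_gt_atTop 0).mono fun d hd => by
      have : (0 : ℝ) < d := by exact_mod_cast hd
      have : 0 < r := by linarith
      simp only [Set.mem_Ioi]
      positivity⟩
  refine h2.inv_tendsto_nhdsGT_zero.congr fun d => ?_
  simp only [Pi.inv_apply, pow_one]
  rw [← mul_div_assoc, inv_div]

theorem tendsto_wishartLDLRNorm_of_one_lt_liminf {N D : ℕ → ℕ} {β ρ : ℕ → ℝ}
    (hN : ∀ n, 1 ≤ n → 1 ≤ N n) (hβ : ∀ n, 1 ≤ n → 0 ≤ β n)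
    (hρ : ∀ n, 1 ≤ n → 0 < ρ n ∧ ρ n ≤ 1) (hD : Tendsto D atTop atTop)
    (hDn : (fun n => (D n : ℝ)) =o[atTop] (fun n => (n : ℝ)))
    (h : 1 < liminf (fun n => (wishartSNR n (N n) (β n) : EReal)) atTop) :
    Tendsto (fun n => wishartLDLRNorm n (N n) (β n) (sparseRademacherPrior n (ρ n)) (D n))
      atTop atTop := by
  obtain ⟨r, hr1, hr⟩ := EReal.lt_iff_exists_real_btwn.1 h
  have hr1 : 1 < r := by exact_mod_cast hr1
  have hsnr : ∀ᶠ n in atTop, r < wishartSNR n (N n) (β n) :=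
    (eventually_lt_of_lt_liminf hr).mono fun n hn => by exact_mod_cast hn
  have hD2 : Tendsto (fun n => D n / 2) atTop atTop :=
    (Nat.tendsto_div_const_atTop two_ne_zero).comp hD
  refine tendsto_atTop_of_le_sq ((tendsto_pow_div_two_mul_atTop hr1).comp hD2)
    (fun n => wishartLDLRNorm_nonneg) ?_
  -- As `D = o(n)`, eventually `d/n ≤ 1 - 1/r`, so `(1 - d/n)^d ≥ r^(-d)`. This costs half of the
  -- growth `r^(2d)` and leaves `r^d / (2d)`.
  have hr0 : 0 < 1 - 1 / r := by
    rw [sub_pos, div_lt_one (by linarith)]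
    exact hr1
  filter_upwards [hsnr, hD2.eventually_gt_atTop 0, eventually_ge_atTop 1, hDn.bound hr0,
    hDn.bound one_pos] with n h1 h2 h3 h4 h5
  simp only [Real.norm_natCast, one_mul] at h4 h5
  have hDle : D n ≤ n := by exact_mod_cast h5
  have hn : (0 : ℝ) < n := by exact_mod_cast h3
  refine le_trans ?_ (le_sq_wishartLDLRNorm_of_snr (d := D n / 2) (hN n h3) (hβ n h3) (hρ n h3).1
    (hρ n h3).2 h2 (by omega) (by omega))
  simp only [Function.comp_apply]
  set d := D n / 2
  have hdD : (d : ℝ) ≤ D n := by exact_mod_cast (by omega : D n / 2 ≤ D n)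
  have h6 : 1 / r ≤ 1 - (d : ℝ) / n := by
    have : (d : ℝ) / n ≤ 1 - 1 / r := by
      rw [div_le_iff₀ hn]
      linarith
    linarith
  have hr' : 0 < r := by linarith
  refine div_le_div_of_nonneg_right ?_ (by positivity)
  have hs0 : 0 < wishartSNR n (N n) (β n) := hr'.trans h1
  calc r ^ d = r ^ (2 * d) * (1 / r) ^ d := by
        rw [two_mul, pow_add, mul_assoc, ← mul_pow, mul_one_div_cancel hr'.ne', one_pow, mul_one]
    _ ≤ _ := by gcongr

theorem tendsto_wishartLDLRNorm_of_sparse {N D : ℕ → ℕ} {β ρ : ℕ → ℝ}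
    (hN : ∀ n, 1 ≤ n → 1 ≤ N n) (hβ : ∀ n, 1 ≤ n → 0 ≤ β n)
    (hρ : ∀ n, 1 ≤ n → 0 < ρ n ∧ ρ n ≤ 1) (hD : Tendsto D atTop atTop)
    (hDn : (fun n => (D n : ℝ)) =o[atTop] (fun n => (n : ℝ)))
    (hlog : (fun n => |Real.log (wishartSNR n (N n) (β n))|) =o[atTop] (fun n => √(D n : ℝ)))
    (hsparse : ∀ᶠ n in atTop,
      ρ n < 1 / 5000 * wishartSNR n (N n) (β n) /
        (max 1 (Real.log (1 / wishartSNR n (N n) (β n)))) ^ 2 * √((D n : ℝ) / n)) :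
    Tendsto (fun n => wishartLDLRNorm n (N n) (β n) (sparseRademacherPrior n (ρ n)) (D n))
      atTop atTop := by
  have hDr : Tendsto (fun n => (D n : ℝ) / 4) atTop atTop :=
    (tendsto_natCast_atTop_atTop.comp hD).atTop_div_const (by norm_num)
  refine tendsto_atTop_of_le_sq hDr (fun n => wishartLDLRNorm_nonneg) ?_
  -- The logarithmic condition is used as `L ≤ 1 + √D`; then `m ≤ 3 + √D`, and `D ≥ 144` ensures `2m
  -- ≤ D`, so that `k ≥ 1`.
  filter_upwards [hsparse, eventually_ge_atTop 1, hDn.bound one_pos, hlog.bound one_pos,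
    hD.eventually_ge_atTop 144] with n h1 h3 h5 h6 h7
  simp only [one_mul, Real.norm_eq_abs, abs_abs,
    abs_of_nonneg (Real.sqrt_nonneg _)] at h5 h6
  have hDle : D n ≤ n := by exact_mod_cast h5
  obtain ⟨hρ0, hρ1⟩ := hρ n h3
  set s := wishartSNR n (N n) (β n) with hs
  set L := max 1 (Real.log (1 / s)) with hL
  have hL1 : 1 ≤ L := le_max_left _ _
  -- If `s` were zero, the strict sparsity bound would read `ρ < 0`.
  have hs0 : 0 < s := by
    refine lt_of_le_of_ne (wishartSNR_nonneg (hβ n h3)) fun h0 => ?_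
    rw [← h0, mul_zero, zero_div, zero_mul] at h1
    linarith
  have hsL : Real.exp (-L) ≤ s := by
    rw [← Real.le_log_iff_exp_le hs0, neg_le, ← Real.log_inv, ← one_div]
    exact le_max_right _ _
  have hLD : L ≤ 1 + √(D n : ℝ) := by
    refine max_le (by linarith [Real.sqrt_nonneg (D n : ℝ)]) ?_
    rw [one_div, Real.log_inv]
    linarith [neg_abs_le (Real.log s)]
  -- The extra `1` guarantees `m ≥ 2`, while `m ≤ L + 2 ≤ 3L` because `L ≥ 1`.
  set m := ⌈L⌉₊ + 1 with hm
  have hLm : L ≤ m := by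
    rw [hm]
    push_cast
    linarith [Nat.le_ceil L]
  have hmL2 : (m : ℝ) ≤ L + 2 := by
    rw [hm]
    push_cast
    linarith [Nat.ceil_lt_add_one (by linarith : 0 ≤ L)]
  have hm2 : 2 ≤ m := by
    have : 0 < ⌈L⌉₊ := Nat.ceil_pos.2 (by linarith)
    omega
  set k := D n / (2 * m) with hk
  have hmD : 2 * m ≤ D n := by
    have h8 : (144 : ℝ) ≤ D n := by exact_mod_cast h7
    have h9 : (12 : ℝ) ≤ √(D n : ℝ) := Real.le_sqrt_of_sq_le (by linarith)
    have h10 := Real.sq_sqrt (Nat.cast_nonneg (α := ℝ) (D n))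
    have : (2 * m : ℝ) ≤ D n := by nlinarith
    exact_mod_cast this
  have hk0 : 0 < k := Nat.div_pos hmD (by omega)
  have hkD : 2 * (k * m) ≤ D n := by
    have := Nat.div_mul_le_self (D n) (2 * m)
    rw [← hk] at this
    linarith
  -- Rounding loses less than `2m`, and `2m ≤ 2km` because `k ≥ 1`.
  have hDk : D n ≤ 4 * (k * m) := by
    have := Nat.lt_div_mul_add (a := D n) (b := 2 * m) (by omega)
    rw [← hk] at this
    nlinarith
  have h := two_pow_le_sq_wishartLDLRNorm_of_sparse (hN n h3) (hβ n h3) hρ0 hρ1 hk0 hm2 hkD hDk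
    hDle hs0 hsL hL1 hLm (by linarith) h1
  refine le_trans ?_ h
  have h11 : (D n : ℝ) ≤ 4 * (k * m : ℕ) := by exact_mod_cast hDk
  have h12 : ((k * m : ℕ) : ℝ) ≤ 2 ^ (k * m) := by exact_mod_cast Nat.lt_two_pow_self.le
  linarith

theorem mainTheorem4 :
    ∃ C : ℝ, 0 < C ∧
      ∀ (N D : ℕ → ℕ) (β ρ : ℕ → ℝ),
        (∀ n, 1 ≤ n → 1 ≤ N n) →
        (∀ n, 1 ≤ n → 0 ≤ β n) →
        (∀ n, 1 ≤ n → 0 < ρ n ∧ ρ n ≤ 1) →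
        Tendsto D atTop atTop →
        (fun n => (D n : ℝ)) =o[atTop] (fun n => (n : ℝ)) →
        (1 < liminf (fun n => (wishartSNR n (N n) (β n) : EReal)) atTop ∨
          (limsup (fun n => (wishartSNR n (N n) (β n) : EReal)) atTop < 1 ∧
            (fun n => |Real.log (wishartSNR n (N n) (β n))|) =o[atTop] (fun n => √(D n : ℝ)) ∧
            ∀ᶠ n in atTop,
              ρ n < C * wishartSNR n (N n) (β n) /
                (max 1 (Real.log (1 / wishartSNR n (N n) (β n)))) ^ 2 * √((D n : ℝ) / n))) →
        Tendsto
          (fun n => wishartLDLRNorm n (N n) (β n) (sparseRademacherPrior n (ρ n)) (D n))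
          atTop atTop := by
  refine ⟨1 / 5000, by norm_num, fun N D β ρ hN hβ hρ hD hDn h => ?_⟩
  rcases h with h | ⟨-, hlog, hsparse⟩
  · exact tendsto_wishartLDLRNorm_of_one_lt_liminf hN hβ hρ hD hDn h
  · exact tendsto_wishartLDLRNorm_of_sparse hN hβ hρ hD hDn hlog hsparse
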